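/- Let $\mathbb K$ be a field and let $Q$ be a finite connected quiver with vertex set $Q_0$ and $n=\# Q_0$. Let $J\subset \mathbb K Q$ be the ideal generated by the arrows, and let $A=\mathbb K Q/J^2$. All modules are finitely generated right $A$-modules; paths are composed from left to right, so that the indecomposable projective at the vertex $i$ is $e_iA$. Let $\Omega M$ be the kernel of a projective cover of $M$, let $\Omega^{-1}M$ be the cokernel of an injective envelope of $M$, and let $A_0=\mathbb K Q/J$ be the direct sum of all simple modules. The support of a module $M$ is the set of vertices $i$ such that the simple module $S_i$ is a composition factor of $M$ (equivalently $Me_i\neq 0$). The heart $C(Q)$ is the full subquiver of $Q$ on the vertices lying in both the support of $\Omega^{n}(A_0)$ and the support of $\Omega^{-n}(A_0)$. The member $M(Q)$ is the full subquiver on the vertices that are not in the heart, and $M(Q)_0$ is its vertex set. Let $K_0$ be the abelian group generated by the symbols $[M]$, one for each isomorphism class of modules, subject to the relations $[M]=[M']+[M'']$ whenever $M\cong M'\oplus M''$ and $[P]=0$ for every projective $P$. Let $\overline\Omega:K_0\to K_0$ be the endomorphism $[M]\mapsto[\Omega M]$, and let $\langle \mathrm{add}\, M\rangle\subseteq K_0$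 be the subgroup generated by the classes of the indecomposable direct summands of $M$. Define $$\phi(M)=\min\{\,l\in\mathbb N : \overline\Omega|_{\overline\Omega^{\,l+s}\langle \mathrm{add}\, M\rangle}\ \text{is injective for all } s\in\mathbb N\,\},\qquad \phi\dim(A)=\sup_M \phi(M).$$ For $x,y\in Q_0$ write $x\preceq y$ if there is a path in $Q$ (possibly of length $0$) starting at $x$ and ending at $y$. **Proposition.** If $M(Q)$ is nonempty and $\phi\dim(A)=n-1$, then $(M(Q)_0,\preceq)$ is a total order (that is, the restriction of $\preceq$ to $M(Q)_0$ is reflexive, transitive, antisymmetric, and any two elements are comparable). -/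

import Mathlib

universe u v w

noncomputable section

namespace RadSq

/-! ## Path algebras and radical square zero algebras -/

section PathAlgebra

open Quiver

/-- The path algebra `K Q` of a quiver `Q` with finitely many vertices: an element is a finitely
supported family of scalars, indexed by the paths of `Q` (sorted by source and target). -/
def PathAlgebra (K : Type u) (Q : Type v) [Quiver.{w} Q] [Field K] : Type (max u v w) :=
  ∀ i j : Q, Path i j →₀ K

variable (K : Type u) [Field K] (Q : Type v) [Quiver.{w} Q]

instance : AddCommGroup (PathAlgebra K Q) :=
  inferInstanceAs (AddCommGroup (∀ i j : Q, Path i j →₀ K))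

instance : Module K (PathAlgebra K Q) :=
  inferInstanceAs (Module K (∀ i j : Q, Path i j →₀ K))

variable {Q}

/-- The bilinear map sending `(p, q)` to the path `p q`: concatenation of paths (first the left one, then the right one). -/
def concat (i j k : Q) : (Path i j →₀ K) →ₗ[K] (Path j k →₀ K) →ₗ[K] (Path i k →₀ K) :=
  Finsupp.lsum K fun p => (LinearMap.ringLmapEquivSelf K K _).symm
    (Finsupp.lmapDomain K K fun q => p.comp q)

@[simp] theorem concat_single (i j k : Q) (p : Path i j) (q : Path j k) (a b : K) :
    concat K i j k (Finsupp.single p a) (Finsupp.single q b)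
      = Finsupp.single (p.comp q) (a * b) := by
  simp [concat]

theorem concat_assoc (i j k l : Q) (f : Path i j →₀ K) (g : Path j k →₀ K) (h : Path k l →₀ K) :
    concat K i k l (concat K i j k f g) h = concat K i j l f (concat K j k l g h) := by
  induction f using Finsupp.induction_linear with
  | zero => simp
  | add f₁ f₂ h₁ h₂ => simp [h₁, h₂]
  | single p a =>
    induction g using Finsupp.induction_linear with
    | zero => simp
    | add f₁ f₂ h₁ h₂ => simp [h₁, h₂]
    | single q b =>
      induction h using Finsupp.induction_linear with
      | zero => simp only [map_zero]
      | add f₁ f₂ h₁ h₂ => simp only [map_add, h₁, h₂]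
      | single r c => simp only [concat_single, mul_assoc, Path.comp_assoc]

theorem nil_concat (i j : Q) (f : Path i j →₀ K) :
    concat K i i j (Finsupp.single Path.nil 1) f = f := by
  induction f using Finsupp.induction_linear with
  | zero => simp
  | add f₁ f₂ h₁ h₂ => simp [h₁, h₂]
  | single p a => simp

theorem concat_nil (i j : Q) (f : Path i j →₀ K) :
    concat K i j j f (Finsupp.single Path.nil 1) = f := by
  induction f using Finsupp.induction_linear with
  | zero => simp
  | add f₁ f₂ h₁ h₂ => simp [h₁, h₂]
  | single p a => simp

theorem add_apply (f g : PathAlgebra K Q) (i k : Q) : (f + g) i k = f i k + g i k := rfl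

theorem zero_apply (i k : Q) : (0 : PathAlgebra K Q) i k = 0 := rfl

theorem smul_apply (a : K) (f : PathAlgebra K Q) (i k : Q) : (a • f) i k = a • f i k := rfl

variable [Fintype Q]

/-- Multiplication of the path algebra: concatenation of composable paths; the product of two paths
that cannot be composed is zero. -/
instance : Mul (PathAlgebra K Q) :=
  ⟨fun f g i k => ∑ j, concat K i j k (f i j) (g j k)⟩

theorem mul_apply (f g : PathAlgebra K Q) (i k : Q) :
    (f * g) i k = ∑ j, concat K i j k (f i j) (g j k) := rfl

variable [DecidableEq Q]

variable {K} in
/-- The path `p`, with coefficient `a`, as an element of the path algebra. -/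
def ofPath {i j : Q} (p : Path i j) (a : K) : PathAlgebra K Q :=
  Pi.single i (Pi.single j (Finsupp.single p a))

/-- The unit is the sum of the trivial paths. -/
instance : One (PathAlgebra K Q) := ⟨∑ i : Q, ofPath (Path.nil : Path i i) 1⟩

theorem one_apply_same (i : Q) : (1 : PathAlgebra K Q) i i = Finsupp.single Path.nil 1 := by
  change (∑ k : Q, ofPath (Path.nil : Path k k) (1 : K)) i i = _
  erw [Finset.sum_apply, Finset.sum_apply]
  rw [Finset.sum_eq_single i]
  · simp [ofPath]
  · intro j _ hj
    simp [ofPath, Pi.single_eq_of_ne (Ne.symm hj)]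
  · simp

theorem one_apply_ne {i j : Q} (h : i ≠ j) : (1 : PathAlgebra K Q) i j = 0 := by
  change (∑ k : Q, ofPath (Path.nil : Path k k) (1 : K)) i j = _
  erw [Finset.sum_apply, Finset.sum_apply]
  refine Finset.sum_eq_zero fun k _ => ?_
  by_cases hk : i = k
  · subst hk
    simp [ofPath, Pi.single_eq_of_ne (Ne.symm h)]
  · simp [ofPath, Pi.single_eq_of_ne hk]

instance : Ring (PathAlgebra K Q) :=
  { (inferInstance : AddCommGroup (PathAlgebra K Q)),
    (inferInstance : Mul (PathAlgebra K Q)),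
    (inferInstance : One (PathAlgebra K Q)) with
    left_distrib := fun f g h => by
      funext i k
      simp only [mul_apply, add_apply, map_add, Finset.sum_add_distrib]
    right_distrib := fun f g h => by
      funext i k
      simp only [mul_apply, add_apply, map_add, LinearMap.add_apply, Finset.sum_add_distrib]
    zero_mul := fun f => by
      funext i k
      simp only [mul_apply, zero_apply, map_zero, LinearMap.zero_apply, Finset.sum_const_zero]
    mul_zero := fun f => by
      funext i k
      simp only [mul_apply, zero_apply, map_zero, Finset.sum_const_zero]
    mul_assoc := fun f g h => by
      funext i l
      simp only [mul_apply, map_sum, LinearMap.sum_apply, concat_assoc]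
      exact Finset.sum_comm
    one_mul := fun f => by
      funext i k
      rw [mul_apply, Finset.sum_eq_single i]
      · rw [one_apply_same, nil_concat]
      · intro j _ hj
        rw [one_apply_ne K (Ne.symm hj), map_zero, LinearMap.zero_apply]
      · simp
    mul_one := fun f => by
      funext i k
      rw [mul_apply, Finset.sum_eq_single k]
      · rw [one_apply_same, concat_nil]
      · intro j _ hj
        rw [one_apply_ne K hj, map_zero]
      · simp }

instance : Algebra K (PathAlgebra K Q) :=
  Algebra.ofModule
    (fun a f g => by
      funext i k
      simp only [mul_apply, smul_apply, map_smul, LinearMap.smul_apply, Finset.smul_sum])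
    (fun a f g => by
      funext i k
      simp only [mul_apply, smul_apply, map_smul, Finset.smul_sum])

theorem ofPath_mul {i j k : Q} (p : Path i j) (q : Path j k) (a b : K) :
    ofPath p a * ofPath q b = ofPath (p.comp q) (a * b) := by
  funext i' k'
  rw [mul_apply, Finset.sum_eq_single j]
  · by_cases hi : i' = i
    · subst hi
      by_cases hk : k' = k
      · subst hk
        simp [ofPath]
      · simp [ofPath, Pi.single_eq_of_ne hk]
    · simp [ofPath, Pi.single_eq_of_ne hi]
  · intro l _ hl
    have : ofPath q b l k' = 0 := by simp [ofPath, Pi.single_eq_of_ne hl]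
    rw [this, map_zero]
  · simp

theorem ofPath_add {i j : Q} (p : Path i j) (a b : K) :
    ofPath p (a + b) = ofPath p a + ofPath p b := by
  simp [ofPath, Finsupp.single_add, Pi.single_add]; rfl

theorem smul_ofPath {i j : Q} (p : Path i j) (a b : K) :
    a • ofPath p b = ofPath p (a * b) := by
  funext i' j'
  rw [smul_apply]
  by_cases hi : i' = i
  · subst hi
    by_cases hj : j' = j
    · subst hj
      simp [ofPath]
    · simp [ofPath, Pi.single_eq_of_ne hj]
  · simp [ofPath, Pi.single_eq_of_ne hi]

theorem span_ofPath : Submodule.span K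
    {x : PathAlgebra K Q | ∃ (i j : Q) (p : Path i j), x = ofPath p 1} = ⊤ := by
  rw [eq_top_iff]
  intro f _
  have hf : f = ∑ i, ∑ j, (f i j).sum fun p a => ofPath p a := by
    have h1 : ∀ (i j : Q) (g : Path i j →₀ K), (g.sum fun p a => (ofPath p a : PathAlgebra K Q)) =
        (Pi.single i (Pi.single j g) : ∀ i j : Q, Path i j →₀ K) := by
      intro i j g
      induction g using Finsupp.induction_linear with
      | zero => simp; rfl
      | add f₁ f₂ h₁ h₂ =>
        rw [Finsupp.sum_add_index' (by intro p; simp [ofPath]; rfl) (fun p a b => ofPath_add K p a b),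
          h₁, h₂, Pi.single_add, Pi.single_add]
        rfl
      | single p a =>
        rw [Finsupp.sum_single_index (by simp [ofPath]; rfl)]
        rfl
    simp only [h1]
    funext i j
    erw [Finset.sum_apply, Finset.sum_apply]
    rw [Finset.sum_eq_single i]
    · erw [Finset.sum_apply, Finset.sum_apply]
      rw [Finset.sum_eq_single j]
      · simp
      · intro b _ hb
        simp [Pi.single_eq_of_ne (Ne.symm hb)]
      · simp
    · intro b _ hb
      erw [Finset.sum_apply, Finset.sum_apply]
      simp [Pi.single_eq_of_ne (Ne.symm hb)]
    · simp
  rw [hf]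
  refine Submodule.sum_mem _ fun i _ => Submodule.sum_mem _ fun j _ =>
    Submodule.sum_mem _ fun p _ => ?_
  have : ofPath p (f i j p) = (f i j p) • (ofPath p 1 : PathAlgebra K Q) := by
    rw [smul_ofPath, mul_one]
  simp only [this]
  exact Submodule.smul_mem _ _ (Submodule.subset_span ⟨i, j, p, rfl⟩)

variable (Q)

/-- The two-sided ideal `J` of `K Q` generated by the arrows. -/
def arrowIdeal : TwoSidedIdeal (PathAlgebra K Q) :=
  TwoSidedIdeal.span {x | ∃ (i j : Q) (a : i ⟶ j), x = ofPath a.toPath 1}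

/-- The two-sided ideal `J²`, generated by the products of two elements of `J`. -/
def arrowIdealSq : TwoSidedIdeal (PathAlgebra K Q) :=
  TwoSidedIdeal.span {z | ∃ x ∈ arrowIdeal K Q, ∃ y ∈ arrowIdeal K Q, z = x * y}

/-- The radical square zero algebra `A = K Q / J²`. -/
abbrev Alg : Type (max u v w) := (arrowIdealSq K Q).ringCon.Quotient

/-- The projection `K Q → A = K Q / J²`. -/
def toAlg : PathAlgebra K Q →+* Alg K Q := (arrowIdealSq K Q).ringCon.mk'

theorem ofPath_mem_arrowIdealSq {i j : Q} (p : Path i j) (hp : 2 ≤ p.length) :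
    ofPath p 1 ∈ arrowIdealSq K Q := by
  match p, hp with
  | .cons (.cons p a) b, _ =>
    have e : (ofPath ((p.cons a).cons b) 1 : PathAlgebra K Q)
        = ofPath p 1 * (ofPath a.toPath 1 * ofPath b.toPath 1) := by
      rw [ofPath_mul, ofPath_mul, mul_one, mul_one]
      rfl
    rw [e]
    exact TwoSidedIdeal.mul_mem_left _ _ _ (TwoSidedIdeal.subset_span
      ⟨_, TwoSidedIdeal.subset_span ⟨_, _, a, rfl⟩, _, TwoSidedIdeal.subset_span ⟨_, _, b, rfl⟩,
        rfl⟩)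

/-- If `Q` is finite, then `K Q / J²` is finite dimensional. -/
instance [∀ i j : Q, Finite (i ⟶ j)] : Module.Finite K (Alg K Q) := by
  let π : PathAlgebra K Q →ₗ[K] Alg K Q :=
    { toFun := toAlg K Q
      map_add' := map_add _
      map_smul' := fun _ _ => rfl }
  have hπ : Function.Surjective π := fun x => Quotient.inductionOn' x fun y => ⟨y, rfl⟩
  let S : Set (Alg K Q) := Set.range (fun i : Q => toAlg K Q (ofPath (Path.nil : Path i i) 1)) ∪
    Set.range (fun a : Σ i j : Q, (i ⟶ j) => toAlg K Q (ofPath a.2.2.toPath 1))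
  have hS : S.Finite := (Set.finite_range _).union (Set.finite_range _)
  refine ⟨⟨hS.toFinset, ?_⟩⟩
  rw [Set.Finite.coe_toFinset, eq_top_iff]
  have h1 : Submodule.map π ⊤ = ⊤ := by
    rw [Submodule.map_top, LinearMap.range_eq_top.mpr hπ]
  rw [← h1, ← span_ofPath, Submodule.map_span, Submodule.span_le]
  rintro _ ⟨_, ⟨i, j, p, rfl⟩, rfl⟩
  match p with
  | .nil => exact Submodule.subset_span (Or.inl ⟨i, rfl⟩)
  | .cons .nil a => exact Submodule.subset_span (Or.inr ⟨⟨_, _, a⟩, rfl⟩)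
  | .cons (.cons p a) b =>
    have : π (ofPath ((p.cons a).cons b) 1) = 0 := by
      have h2 := ofPath_mem_arrowIdealSq K Q ((p.cons a).cons b) (by simp)
      exact Quotient.sound' h2
    rw [this]
    exact Submodule.zero_mem _

end PathAlgebra
/-! ## Finitely generated modules: projective covers, injective envelopes, syzygies

We work with left modules over a ring `R`; right `A`-modules are left modules over `R = Aᵐᵒᵖ`. -/

section Modules

variable {R : Type v} [Ring R]

/-- `f : P → M` is a projective cover: `P` is projective, `f` is onto and its kernel is superfluous
in `P`. -/
structure IsProjectiveCover {P M : Type v} [AddCommGroup P] [Module R P] [AddCommGroup M]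
    [Module R M] (f : P →ₗ[R] M) : Prop where
  projective : Module.Projective R P
  surjective : Function.Surjective f
  superfluous : ∀ N : Submodule R P, N ⊔ LinearMap.ker f = ⊤ → N = ⊤

/-- `f : M → I` is an injective envelope: `I` is injective, `f` is one-to-one and its image is
essential in `I`. -/
structure IsInjectiveEnvelope {M I : Type v} [AddCommGroup M] [Module R M] [AddCommGroup I]
    [Module R I] (f : M →ₗ[R] I) : Prop where
  injective_module : Module.Injective R I
  injective : Function.Injective f
  essential : ∀ N : Submodule R I, N ⊓ LinearMap.range f = ⊥ → N = ⊥

/-- Finitely generated modules over an Artinian ring have projective covers. -/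
theorem exists_projectiveCover [IsArtinianRing R] (M : FGModuleCat.{v} R) :
    ∃ (P : FGModuleCat.{v} R) (f : P →ₗ[R] M), IsProjectiveCover f := by
  obtain ⟨n, π, hπ⟩ := Module.Finite.exists_fin' R M
  let S : Set (Submodule R (Fin n → R)) :=
    {N | Module.Projective R N ∧ Function.Surjective (π ∘ₗ N.subtype)}
  have hS : S.Nonempty := by
    refine ⟨⊤, Module.Projective.of_equiv (Submodule.topEquiv (R := R) (M := Fin n → R)).symm, ?_⟩
    intro m
    obtain ⟨x, hx⟩ := hπ m
    exact ⟨⟨x, trivial⟩, hx⟩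
  obtain ⟨N, ⟨hNp, hNs⟩, hmin⟩ := WellFounded.has_min (wellFounded_lt (α := Submodule R (Fin n → R)))
    S hS
  refine ⟨FGModuleCat.of R N, π ∘ₗ N.subtype, hNp, hNs, fun L hL => ?_⟩
  set f : N →ₗ[R] M := π ∘ₗ N.subtype with hf
  change Submodule R N at L
  have hfL : Function.Surjective (f ∘ₗ L.subtype) := by
    intro m
    obtain ⟨x, hx⟩ := hNs m
    obtain ⟨y, hy, z, hz, hyz⟩ := Submodule.mem_sup.1 (show x ∈ L ⊔ LinearMap.ker f by
      rw [show L ⊔ LinearMap.ker f = ⊤ from hL]; trivial)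
    refine ⟨⟨y, hy⟩, ?_⟩
    change f y = m
    rw [← hx, ← hyz]
    have : f z = 0 := hz
    change f y = f (y + z)
    rw [map_add, this, add_zero]
  obtain ⟨g, hg⟩ := Module.projective_lifting_property (f ∘ₗ L.subtype) f hfL
  let e : Module.End R N := L.subtype ∘ₗ g
  have hfe : ∀ k : ℕ, ∀ x, f ((e ^ k) x) = f x := by
    intro k
    induction k with
    | zero => simp
    | succ k ih =>
      intro x
      rw [pow_succ, Module.End.mul_apply, ih]
      exact LinearMap.congr_fun hg x
  obtain ⟨k, hk⟩ := Filter.eventually_atTop.1 e.eventually_isCompl_ker_pow_range_pow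
  have hc := hk (k + 1) (Nat.le_succ k)
  set T : Submodule R N := LinearMap.range (e ^ (k + 1)) with hT
  have hTL : T ≤ L := by
    rintro _ ⟨x, rfl⟩
    rw [pow_succ', Module.End.mul_apply]
    exact (g _).2
  have hTp : Module.Projective R T :=
    Module.Projective.of_split T.subtype (Submodule.projectionOnto T _ hc.symm) (by
      ext x; simp)
  have hmem : T.map N.subtype ∈ S := by
    refine ⟨Module.Projective.of_equiv (Submodule.equivSubtypeMap N T), fun m => ?_⟩
    obtain ⟨x, hx⟩ := hNs m
    refine ⟨⟨(e ^ (k + 1)) x, ⟨(e ^ (k + 1)) x, ⟨x, rfl⟩, rfl⟩⟩, ?_⟩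
    exact (hfe (k + 1) x).trans hx
  have hle : N ≤ T.map N.subtype := by
    by_contra hlt
    exact hmin _ hmem (lt_of_le_not_ge (Submodule.map_subtype_le N T) hlt)
  rw [eq_top_iff]
  intro x _
  obtain ⟨y, hy, hyx⟩ := hle x.2
  have : y = x := Subtype.ext hyx
  exact this ▸ hTL hy

section Coinduced

variable (K : Type u) [Field K] [Algebra K R]

variable (R) in
/-- The coinduced module `Hom_K(R, M)`, an injective `R`-module. -/
def Coind (M : Type v) [AddCommGroup M] [Module K M] : Type v := R →ₗ[K] M

variable (M : Type v) [AddCommGroup M] [Module K M]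

variable {K M} in
/-- The linear map underlying an element of the coinduced module. -/
def Coind.toLin (φ : Coind R K M) : R →ₗ[K] M := φ

instance : AddCommGroup (Coind R K M) := inferInstanceAs (AddCommGroup (R →ₗ[K] M))

instance : Module K (Coind R K M) := inferInstanceAs (Module K (R →ₗ[K] M))

instance : Module R (Coind R K M) where
  smul r φ := LinearMap.comp φ.toLin (LinearMap.mulRight K r)
  one_smul φ := LinearMap.ext fun x => congrArg φ.toLin (mul_one x)
  mul_smul r s φ := LinearMap.ext fun x => congrArg φ.toLin (mul_assoc x r s).symm
  smul_zero _ := rfl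
  smul_add _ _ _ := rfl
  add_smul r s φ := LinearMap.ext fun x =>
    (congrArg φ.toLin (mul_add x r s)).trans (map_add φ.toLin _ _)
  zero_smul φ := LinearMap.ext fun x =>
    (congrArg φ.toLin (mul_zero x)).trans (map_zero φ.toLin)

instance : IsScalarTower K R (Coind R K M) where
  smul_assoc a r φ := LinearMap.ext fun x => by
    change φ.toLin (x * (a • r)) = a • φ.toLin (x * r)
    rw [mul_smul_comm, map_smul]

theorem coind_injective : Module.Injective R (Coind R K M) := by
  refine Module.Baer.injective fun I g => ?_
  let g₁ : (I.restrictScalars K : Submodule K R) →ₗ[K] M :=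
    { toFun := fun x => (g ⟨x.1, x.2⟩).toLin 1
      map_add' := fun x y => by
        have := congrArg (fun φ : Coind R K M => φ.toLin 1) (map_add g ⟨x.1, x.2⟩ ⟨y.1, y.2⟩)
        exact this
      map_smul' := fun a x => by
        have h := congrArg (fun φ : Coind R K M => φ.toLin 1)
          (map_smul g (algebraMap K R a) ⟨x.1, x.2⟩)
        have h2 : (algebraMap K R a) • (⟨x.1, x.2⟩ : I) = ⟨(a • x).1, (a • x).2⟩ := by
          ext
          exact (Algebra.smul_def a x.1).symm
        rw [h2] at h
        refine h.trans ?_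
        change (g ⟨x.1, x.2⟩).toLin (1 * algebraMap K R a) = _
        rw [one_mul, Algebra.algebraMap_eq_smul_one, map_smul]
        rfl }
  obtain ⟨h, hh⟩ := LinearMap.exists_extend g₁
  let h' : R →ₗ[R] Coind R K M := LinearMap.toSpanSingleton R _ (h : Coind R K M)
  refine ⟨h', fun x hx => LinearMap.ext fun r => ?_⟩
  change h (r * x) = (g ⟨x, hx⟩).toLin r
  have h3 := LinearMap.congr_fun hh ⟨r * x, I.mul_mem_left r hx⟩
  refine h3.trans ?_
  have h4 := congrArg (fun φ : Coind R K M => φ.toLin 1) (map_smul g r ⟨x, hx⟩)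
  refine h4.trans ?_
  change (g ⟨x, hx⟩).toLin (1 * r) = _
  rw [one_mul]

end Coinduced

theorem injective_of_split {I L : Type v} [AddCommGroup I] [Module R I] [AddCommGroup L]
    [Module R L] (h : Module.Injective R I) (i : L →ₗ[R] I) (s : I →ₗ[R] L)
    (hs : ∀ x, s (i x) = x) : Module.Injective R L where
  out X Y _ _ _ _ f hf g := by
    obtain ⟨k, hk⟩ := h.out f hf (i ∘ₗ g)
    exact ⟨s ∘ₗ k, fun x => by rw [LinearMap.comp_apply, hk, LinearMap.comp_apply, hs]⟩

/-- Finitely generated modules over a finite dimensional algebra have finitely generated injective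
envelopes. -/
theorem exists_injectiveEnvelope (K : Type u) [Field K] [Algebra K R] [Module.Finite K R]
    (M : FGModuleCat.{v} R) :
    ∃ (I : FGModuleCat.{v} R) (f : M →ₗ[R] I), IsInjectiveEnvelope f := by
  have : IsArtinianRing R := IsArtinianRing.of_finite K R
  let _ : Module K M := Module.compHom M (algebraMap K R)
  have : IsScalarTower K R M := IsScalarTower.of_algebraMap_smul fun _ _ => rfl
  have : Module.Finite K M := Module.Finite.trans R M
  have : Module.Finite K (Coind R K M) := inferInstanceAs (Module.Finite K (R →ₗ[K] M))
  have : Module.Finite R (Coind R K M) := Module.Finite.of_restrictScalars_finite K R _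
  let ι : M →ₗ[R] Coind R K M :=
    { toFun := fun m => ((LinearMap.toSpanSingleton R M m).restrictScalars K : R →ₗ[K] M)
      map_add' := fun x y => LinearMap.ext fun r => smul_add r x y
      map_smul' := fun s x => LinearMap.ext fun r => (smul_smul r s x) }
  have hι : Function.Injective ι := fun x y h => by
    have h1 : (1 : R) • x = (1 : R) • y := congrArg (fun φ : R →ₗ[K] M => φ 1) h
    simpa using h1
  let S : Set (Submodule R (Coind R K M)) := {N | Module.Injective R N ∧ LinearMap.range ι ≤ N}
  have hS : S.Nonempty := by
    refine ⟨⊤, injective_of_split (coind_injective K M) (Submodule.subtype ⊤)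
      (Submodule.topEquiv (R := R) (M := Coind R K M)).symm.toLinearMap (fun x => rfl), le_top⟩
  obtain ⟨N, ⟨hNi, hNr⟩, hmin⟩ :=
    WellFounded.has_min (wellFounded_lt (α := Submodule R (Coind R K M))) S hS
  let f : M →ₗ[R] N := ι.codRestrict N fun x => hNr ⟨x, rfl⟩
  have hf : Function.Injective f := fun x y h => hι (congrArg Subtype.val h)
  refine ⟨FGModuleCat.of R N, f, hNi, hf, fun L hL => ?_⟩
  change Submodule R N at L
  have hfL : Function.Injective (L.mkQ ∘ₗ f) := by
    rw [← LinearMap.ker_eq_bot, eq_bot_iff]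
    intro x hx
    have h1 : f x ∈ L := by
      rw [LinearMap.mem_ker, LinearMap.comp_apply] at hx
      simpa using hx
    have h2 : f x ∈ L ⊓ LinearMap.range f := ⟨h1, ⟨x, rfl⟩⟩
    have h3 : L ⊓ LinearMap.range f = ⊥ := hL
    rw [h3, Submodule.mem_bot] at h2
    exact hf (by rw [h2, map_zero])
  obtain ⟨g, hg⟩ := hNi.out (L.mkQ ∘ₗ f) hfL f
  let e : Module.End R N := g ∘ₗ L.mkQ
  have hef : ∀ k : ℕ, ∀ x, (e ^ k) (f x) = f x := by
    intro k
    induction k with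
    | zero => simp
    | succ k ih =>
      intro x
      rw [pow_succ, Module.End.mul_apply]
      have h1 : e (f x) = f x := hg x
      rw [h1, ih]
  obtain ⟨k, hk⟩ := Filter.eventually_atTop.1 e.eventually_isCompl_ker_pow_range_pow
  have hc := hk (k + 1) (Nat.le_succ k)
  set T : Submodule R N := LinearMap.range (e ^ (k + 1)) with hT
  have hTi : Module.Injective R T :=
    injective_of_split hNi T.subtype (Submodule.projectionOnto T _ hc.symm) (by
      intro x; simp)
  have hmem : T.map N.subtype ∈ S := by
    refine ⟨injective_of_split hTi (Submodule.equivSubtypeMap N T).symm.toLinearMap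
      (Submodule.equivSubtypeMap N T).toLinearMap (fun x => by simp), ?_⟩
    rintro _ ⟨x, rfl⟩
    exact ⟨f x, ⟨f x, hef _ x⟩, rfl⟩
  have hle : N ≤ T.map N.subtype := by
    by_contra hlt
    exact hmin _ hmem (lt_of_le_not_ge (Submodule.map_subtype_le N T) hlt)
  have hTtop : T = ⊤ := by
    rw [eq_top_iff]
    intro x _
    obtain ⟨y, hy, hyx⟩ := hle x.2
    have : y = x := Subtype.ext hyx
    exact this ▸ hy
  have hker : LinearMap.ker (e ^ (k + 1)) = ⊥ := by
    have := hc.disjoint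
    rw [hTtop] at this
    exact disjoint_top.1 this
  rw [eq_bot_iff, ← hker]
  intro x hx
  rw [LinearMap.mem_ker, pow_succ, Module.End.mul_apply]
  have h1 : e x = 0 := by
    change g (L.mkQ x) = 0
    rw [show L.mkQ x = 0 by simpa using hx, map_zero]
  rw [h1, map_zero]

/-- The syzygy `Ω M`: the kernel of a projective cover of `M`. -/
def syzygy [IsArtinianRing R] (M : FGModuleCat.{v} R) : FGModuleCat.{v} R :=
  FGModuleCat.of R (LinearMap.ker (exists_projectiveCover M).choose_spec.choose)

/-- The cosyzygy `Ω⁻¹ M`: the cokernel of an injective envelope of `M`. -/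
def cosyzygy (K : Type u) [Field K] [Algebra K R] [Module.Finite K R] (M : FGModuleCat.{v} R) :
    FGModuleCat.{v} R :=
  FGModuleCat.of R ((exists_injectiveEnvelope K M).choose ⧸
    LinearMap.range (exists_injectiveEnvelope K M).choose_spec.choose)

/-! ## The Igusa-Todorov function -/

variable (R) in
/-- The subgroup of relations defining `K₀`: the elements `[M] - [M'] - [M'']` for
`M ≅ M' ⊕ M''`, and `[P]` for `P` projective. -/
def K0Relations : AddSubgroup (FreeAbelianGroup (FGModuleCat.{v} R)) :=
  AddSubgroup.closure
    ({x | ∃ M M' M'' : FGModuleCat.{v} R, Nonempty (M ≃ₗ[R] M' × M'') ∧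
        x = FreeAbelianGroup.of M - FreeAbelianGroup.of M' - FreeAbelianGroup.of M''} ∪
      {x | ∃ P : FGModuleCat.{v} R, Module.Projective R P ∧ x = FreeAbelianGroup.of P})

variable (R) in
/-- The group `K₀` of finitely generated modules modulo direct sums and projectives. (Isomorphic
modules have the same class, by the relation `M ≅ M' ⊕ 0`.) -/
abbrev K0 : Type (v + 1) := FreeAbelianGroup (FGModuleCat.{v} R) ⧸ K0Relations R

/-- The class `[M]` in `K₀`. -/
def cls (M : FGModuleCat.{v} R) : K0 R := QuotientAddGroup.mk (FreeAbelianGroup.of M)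

theorem cls_prod {M M' M'' : FGModuleCat.{v} R} (e : M ≃ₗ[R] M' × M'') :
    cls M = cls M' + cls M'' := by
  have h : (QuotientAddGroup.mk (FreeAbelianGroup.of M - FreeAbelianGroup.of M' -
      FreeAbelianGroup.of M'') : K0 R) = 0 :=
    (QuotientAddGroup.eq_zero_iff _).2
      (AddSubgroup.subset_closure (Or.inl ⟨M, M', M'', ⟨e⟩, rfl⟩))
  have h2 : cls M - cls M' - cls M'' = 0 := h
  rw [sub_sub, sub_eq_zero] at h2
  exact h2

theorem cls_projective (P : FGModuleCat.{v} R) (h : Module.Projective R P) : cls P = 0 :=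
  (QuotientAddGroup.eq_zero_iff _).2 (AddSubgroup.subset_closure (Or.inr ⟨P, h, rfl⟩))

/-- The kernels of any two projective presentations of `M` have the same class. -/
theorem cls_ker_eq [IsNoetherianRing R] {M : Type v} [AddCommGroup M] [Module R M]
    (P P' : FGModuleCat.{v} R) (hP : Module.Projective R P) (hP' : Module.Projective R P')
    (f : P →ₗ[R] M) (f' : P' →ₗ[R] M) (hf : Function.Surjective f)
    (hf' : Function.Surjective f') :
    cls (FGModuleCat.of R (LinearMap.ker f)) = cls (FGModuleCat.of R (LinearMap.ker f')) := by
  obtain ⟨s, hs⟩ := Module.projective_lifting_property f' f hf'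
  obtain ⟨t, ht⟩ := Module.projective_lifting_property f f' hf
  have hs' : ∀ x, f' (s x) = f x := LinearMap.congr_fun hs
  have ht' : ∀ x, f (t x) = f' x := LinearMap.congr_fun ht
  let L := LinearMap.ker (f.coprod f')
  have e1 : L ≃ₗ[R] P × LinearMap.ker f' :=
    { toFun := fun x => (x.1.1, ⟨x.1.2 + s x.1.1, by
        have := x.2
        rw [LinearMap.mem_ker, LinearMap.coprod_apply] at this
        rw [LinearMap.mem_ker, map_add, hs', add_comm, this]⟩)
      map_add' := fun x y => by
        ext
        · rfl
        · simp; abel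
      map_smul' := fun r x => by
        ext
        · rfl
        · simp
      invFun := fun y => ⟨(y.1, y.2.1 - s y.1), by
        have := y.2.2
        rw [LinearMap.mem_ker] at this
        rw [LinearMap.mem_ker, LinearMap.coprod_apply, map_sub, hs', this]
        simp⟩
      left_inv := fun x => by ext <;> simp
      right_inv := fun y => by ext <;> simp }
  have e2 : L ≃ₗ[R] P' × LinearMap.ker f :=
    { toFun := fun x => (x.1.2, ⟨x.1.1 + t x.1.2, by
        have := x.2
        rw [LinearMap.mem_ker, LinearMap.coprod_apply] at this
        rw [LinearMap.mem_ker, map_add, ht', this]⟩)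
      map_add' := fun x y => by
        ext
        · rfl
        · simp; abel
      map_smul' := fun r x => by
        ext
        · rfl
        · simp
      invFun := fun y => ⟨(y.2.1 - t y.1, y.1), by
        have := y.2.2
        rw [LinearMap.mem_ker] at this
        rw [LinearMap.mem_ker, LinearMap.coprod_apply, map_sub, ht', this]
        simp⟩
      left_inv := fun x => by ext <;> simp
      right_inv := fun y => by ext <;> simp }
  have h1 := cls_prod (M := FGModuleCat.of R L) (M' := P)
    (M'' := FGModuleCat.of R (LinearMap.ker f')) e1
  have h2 := cls_prod (M := FGModuleCat.of R L) (M' := P')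
    (M'' := FGModuleCat.of R (LinearMap.ker f)) e2
  rw [cls_projective P hP, zero_add] at h1
  rw [cls_projective P' hP', zero_add] at h2
  rw [← h1, ← h2]

section Phi

variable [IsArtinianRing R]

theorem cls_syzygy {M : FGModuleCat.{v} R} (P : FGModuleCat.{v} R) (hP : Module.Projective R P)
    (f : P →ₗ[R] M) (hf : Function.Surjective f) :
    cls (syzygy M) = cls (FGModuleCat.of R (LinearMap.ker f)) :=
  cls_ker_eq _ _ (exists_projectiveCover M).choose_spec.choose_spec.projective hP _ _
    (exists_projectiveCover M).choose_spec.choose_spec.surjective hf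

variable (R) in
/-- The endomorphism of `K₀` induced by `Ω`, that is `[M] ↦ [Ω M]`. -/
def omegaBar : K0 R →+ K0 R :=
  QuotientAddGroup.lift (K0Relations R) (FreeAbelianGroup.lift fun M => cls (syzygy M)) (by
    refine (AddSubgroup.closure_le _).2 ?_
    rintro _ (⟨M, M', M'', ⟨e⟩, rfl⟩ | ⟨P, hP, rfl⟩)
    · rw [SetLike.mem_coe, AddMonoidHom.mem_ker, map_sub, map_sub, FreeAbelianGroup.lift_apply_of,
        FreeAbelianGroup.lift_apply_of, FreeAbelianGroup.lift_apply_of]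
      obtain ⟨P', f', h'⟩ := exists_projectiveCover M'
      obtain ⟨P'', f'', h''⟩ := exists_projectiveCover M''
      have hp' := h'.projective
      have hp'' := h''.projective
      have h1 := cls_syzygy P' hp' f' h'.surjective
      have h2 := cls_syzygy P'' hp'' f'' h''.surjective
      have h3 := cls_syzygy (M := M) (FGModuleCat.of R (P' × P''))
        (inferInstanceAs (Module.Projective R (P' × P'')))
        (e.symm.toLinearMap ∘ₗ f'.prodMap f'')
        (e.symm.surjective.comp (Function.Surjective.prodMap h'.surjective h''.surjective))
      have e3 : LinearMap.ker (e.symm.toLinearMap ∘ₗ f'.prodMap f'') ≃ₗ[R]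
          LinearMap.ker f' × LinearMap.ker f'' :=
        { toFun := fun x => (⟨x.1.1, by
              have := x.2
              simp at this
              exact this.1⟩, ⟨x.1.2, by
              have := x.2
              simp at this
              exact this.2⟩)
          map_add' := fun x y => rfl
          map_smul' := fun r x => rfl
          invFun := fun y => ⟨(y.1.1, y.2.1), by simp⟩
          left_inv := fun x => rfl
          right_inv := fun y => rfl }
      have h4 := cls_prod (M := FGModuleCat.of R
          (LinearMap.ker (e.symm.toLinearMap ∘ₗ f'.prodMap f'')))
        (M' := FGModuleCat.of R (LinearMap.ker f'))
        (M'' := FGModuleCat.of R (LinearMap.ker f'')) e3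
      rw [h3, h1, h2]
      erw [h4]
      abel
    · rw [SetLike.mem_coe, AddMonoidHom.mem_ker, FreeAbelianGroup.lift_apply_of,
        cls_syzygy P hP LinearMap.id Function.surjective_id]
      apply cls_projective
      have : Subsingleton (LinearMap.ker (LinearMap.id : P →ₗ[R] P)) := by
        rw [LinearMap.ker_id]; infer_instance
      change Module.Projective R (LinearMap.ker (LinearMap.id : P →ₗ[R] P))
      infer_instance)

@[simp] theorem omegaBar_cls (M : FGModuleCat.{v} R) : omegaBar R (cls M) = cls (syzygy M) := by
  change FreeAbelianGroup.lift _ (FreeAbelianGroup.of M) = _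
  rw [FreeAbelianGroup.lift_apply_of]

/-- `N` is indecomposable: it is nonzero, and is not the direct sum of two nonzero modules. -/
def IsIndecomposable (N : FGModuleCat.{v} R) : Prop :=
  Nontrivial N ∧ ∀ N' N'' : FGModuleCat.{v} R, Nonempty (N ≃ₗ[R] N' × N'') →
    Subsingleton N' ∨ Subsingleton N''

/-- `N` is (isomorphic to) a direct summand of `M`. -/
def IsDirectSummand (N M : FGModuleCat.{v} R) : Prop :=
  ∃ L : FGModuleCat.{v} R, Nonempty (M ≃ₗ[R] N × L)

/-- The subgroup `⟨add M⟩` of `K₀` generated by the classes of the indecomposable direct summands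
of `M`. -/
def addSpan (M : FGModuleCat.{v} R) : AddSubgroup (K0 R) :=
  AddSubgroup.closure {x | ∃ N, IsIndecomposable N ∧ IsDirectSummand N M ∧ x = cls N}

/-- The Igusa-Todorov function `φ`: the least `l` such that `Ω̄` is a monomorphism on
`Ω̄^(l+s) ⟨add M⟩` for all `s` (it would be `⊤` if there were no such `l`). -/
def phi (M : FGModuleCat.{v} R) : ℕ∞ :=
  sInf ((fun l : ℕ => (l : ℕ∞)) ''
    {l : ℕ | ∀ s : ℕ, Set.InjOn (omegaBar R) ((omegaBar R)^[l + s] '' (addSpan M : Set (K0 R)))})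

variable (R) in
/-- The `φ`-dimension: the supremum of `φ(M)` over all finitely generated modules `M`. -/
def phiDim : ℕ∞ := ⨆ M : FGModuleCat.{v} R, phi M

end Phi

end Modules
/-! ## Heart and member of a quiver -/

section Heart

variable (K : Type u) [Field K] (Q : Type v) [Quiver.{w} Q] [Fintype Q] [DecidableEq Q]

/-- The image in `A` of the trivial path at the vertex `i`. -/
def idem (i : Q) : Alg K Q := toAlg K Q (ofPath (Quiver.Path.nil : Quiver.Path i i) 1)

instance : Module.Finite (Alg K Q)ᵐᵒᵖ (Alg K Q) :=
  Module.Finite.of_surjective (LinearMap.toSpanSingleton (Alg K Q)ᵐᵒᵖ (Alg K Q) 1)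
    fun x => ⟨MulOpposite.op x, by simp⟩

/-- The right `A`-module `A₀ = K Q / J = A / (J / J²)`, the direct sum of all simple modules. -/
def A0 : FGModuleCat.{max u v w} (Alg K Q)ᵐᵒᵖ :=
  FGModuleCat.of (Alg K Q)ᵐᵒᵖ
    (Alg K Q ⧸ Submodule.span (Alg K Q)ᵐᵒᵖ (toAlg K Q '' (arrowIdeal K Q : Set (PathAlgebra K Q))))

variable {K Q} in
/-- The support of a right `A`-module `M`: the vertices `i` with `M e_i ≠ 0`, that is, those whose
simple module `S_i` is a composition factor of `M`. -/
def support (M : FGModuleCat.{max u v w} (Alg K Q)ᵐᵒᵖ) : Set Q :=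
  {i | ∃ x : M, MulOpposite.op (idem K Q i) • x ≠ 0}

variable [∀ i j : Q, Finite (i ⟶ j)]

instance : IsArtinianRing (Alg K Q)ᵐᵒᵖ := IsArtinianRing.of_finite K _

/-- The vertices of the heart `C(Q)`: those in the supports of both `Ωⁿ(A₀)` and `Ω⁻ⁿ(A₀)`, where
`n` is the number of vertices. -/
def heart : Set Q :=
  support (syzygy^[Fintype.card Q] (A0 K Q)) ∩ support ((cosyzygy K)^[Fintype.card Q] (A0 K Q))

/-- The vertices of the member `M(Q)`: those which are not in the heart. -/
def member : Set Q := (heart K Q)ᶜ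

variable {Q} in
/-- The path preorder on the vertices: there is a path of `Q` from `x` to `y`. -/
def PathLE (x y : Q) : Prop := Nonempty (Quiver.Path x y)

end Heart

end RadSq

end

/-! Reflexivity and transitivity are immediate; the rest compares walks in `Q` with syzygies. Let
`T` be the adjacency matrix. An arrow `i ⟶ j` carries `i` in the support of a module killed by
arrows to `j` in the support of its syzygy (`mem_support_syzygy`), and dually for cosyzygies
(`mem_support_cosyzygy`). Hence the heart contains the core, the vertices at which a walk of length
`n` ends and another one starts (`level_inter_subset_heart`). Distinct vertices that reach each
other lie on a closed walk, so they are in the heart: this is antisymmetry.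

For comparability, suppose that `x` and `y` off the heart are incomparable; then `φdim ≤ n - 2`. A
syzygy lies in the radical of a projective, so it is a sum of simples at vertices that are not
sources. On combinations of simples, `Ω̄` acts by `v ↦ v T` (`omegaBar_simpleComb`). Simples at
sinks are projective and vanish in `K₀`, while the others are independent (`exists_multHom`). By
`phiDim_le` it is enough that a vector `v`, supported off the sources and killed by some power of
`T`, has `v T ^ (n - 3)` supported on the sinks.

To see this (`vecMul_pow_card_sub_three`), split the vertices into `U`, not reached by long walks,
the core `C`, and the remaining set `D`. Both `U` and `D` are acyclic, `U` is closed under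
predecessors and `D` under successors. Starting off the sources, `v` leaves `U` within `#U - 1`
steps. The block of `T` at `C` has no zero row, so it is not nilpotent, and `#C - 1` further steps
clear `C`. Within `D` another `#D - 1` steps lead to the sinks. If all three sets are nonempty, the
total is `n - 3`. If `C` is nonempty and `U` or `D` is empty, one unit is missing; then `x` and `y`
lie in the same acyclic part, where no chain contains both, and this recovers the unit. If `C` is
empty, the whole quiver is acyclic and the same chain argument applies to it. -/

namespace RadSq

/-! ### Long walks in a finite relation. -/

section Levels

variable {V : Type v} (r : V → V → Prop)

/-- The set of vertices at which a walk of length `k` along the relation `r` ends. -/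
def level : ℕ → Set V
  | 0 => Set.univ
  | k + 1 => {j | ∃ i ∈ level k, r i j}

theorem level_succ_subset (k : ℕ) : level r (k + 1) ⊆ level r k := by
  induction k with
  | zero => exact Set.subset_univ _
  | succ k ih => exact fun j ⟨i, hi, hij⟩ => ⟨i, ih hi, hij⟩

theorem level_antitone : Antitone (level r) := antitone_nat_of_succ_le (level_succ_subset r)

/-- A closed walk can be followed backwards for ever: the predecessor of `u` on it lies on a closed
walk as well, namely the rotated one. -/
theorem mem_level_of_transGen_self (k : ℕ) {u : V} (h : Relation.TransGen r u u) :
    u ∈ level r k := by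
  induction k generalizing u with
  | zero => trivial
  | succ k ih =>
    obtain ⟨w, h1, h2⟩ := Relation.TransGen.tail'_iff.1 h
    exact ⟨w, ih (Relation.TransGen.head' h2 h1), h2⟩

theorem not_transGen_self_of_notMem_level {k : ℕ} {z : V} (hz : z ∉ level r k) :
    ¬ Relation.TransGen r z z := fun h => hz (mem_level_of_transGen_self r _ h)

/-- A walk of length `k` ending in a set `Z` that is closed under predecessors and contains no
closed walk yields a chain of `k + 1` elements of `Z`. -/
theorem exists_chain_of_mem_level [DecidableEq V] {Z : Set V}
    (hZ : ∀ i j, r i j → j ∈ Z → i ∈ Z) (hacyc : ∀ z ∈ Z, ¬ Relation.TransGen r z z) (k : ℕ)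
    {u : V} (hu : u ∈ level r k) (huZ : u ∈ Z) :
    ∃ C : Finset V, C.card = k + 1 ∧ (∀ c ∈ C, c ∈ Z) ∧ (∀ c ∈ C, Relation.ReflTransGen r c u) ∧
      ∀ c ∈ C, ∀ d ∈ C, Relation.ReflTransGen r c d ∨ Relation.ReflTransGen r d c := by
  induction k generalizing u with
  | zero =>
    refine ⟨{u}, rfl, ?_, ?_, ?_⟩ <;> simp [huZ, Relation.ReflTransGen.refl]
  | succ k ih =>
    obtain ⟨w, hw, hwu⟩ := hu
    obtain ⟨C, h1, h2, h3, h4⟩ := ih hw (hZ _ _ hwu huZ)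
    have h5 : ∀ c ∈ C, Relation.ReflTransGen r c u := fun c hc => (h3 c hc).tail hwu
    refine ⟨insert u C, ?_, ?_, ?_, ?_⟩
    · rw [Finset.card_insert_of_notMem, h1]
      -- Every element of `C` reaches `w`, so `u ∈ C` together with `w → u` would give a closed walk
      -- at `u`.
      exact fun h => hacyc u huZ (Relation.TransGen.tail' (h3 u h) hwu)
    · intro c hc
      rcases Finset.mem_insert.1 hc with rfl | hc
      exacts [huZ, h2 c hc]
    · intro c hc
      rcases Finset.mem_insert.1 hc with rfl | hc
      exacts [.refl, h5 c hc]
    · intro c hc d hd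
      rcases Finset.mem_insert.1 hc with rfl | hc'
      · rcases Finset.mem_insert.1 hd with rfl | hd'
        exacts [.inl .refl, .inr (h5 d hd')]
      · rcases Finset.mem_insert.1 hd with rfl | hd'
        exacts [.inl (h5 c hc'), h4 c hc' d hd']

variable [Fintype V]

theorem lt_ncard_of_mem_level {Z : Set V}
    (hZ : ∀ i j, r i j → j ∈ Z → i ∈ Z) (hacyc : ∀ z ∈ Z, ¬ Relation.TransGen r z z) {k : ℕ}
    {u : V} (hu : u ∈ level r k) (huZ : u ∈ Z) : k < Z.ncard := by
  classical
  obtain ⟨C, h1, h2, -, -⟩ := exists_chain_of_mem_level r hZ hacyc k hu huZ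
  have : C.card ≤ Z.ncard := by
    rw [← Set.ncard_coe_finset]
    exact Set.ncard_le_ncard h2
  lia

/-- The chain given by the walk is totally preordered, so it misses `x` or `y`; this improves
`lt_ncard_of_mem_level` by one. -/
theorem succ_lt_ncard_of_mem_level {Z : Set V}
    (hZ : ∀ i j, r i j → j ∈ Z → i ∈ Z) (hacyc : ∀ z ∈ Z, ¬ Relation.TransGen r z z) {k : ℕ}
    {u : V} (hu : u ∈ level r k) (huZ : u ∈ Z) {x y : V} (hx : x ∈ Z) (hy : y ∈ Z)
    (hxy : ¬ Relation.ReflTransGen r x y) (hyx : ¬ Relation.ReflTransGen r y x) :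
    k + 1 < Z.ncard := by
  classical
  obtain ⟨C, h1, h2, -, h4⟩ := exists_chain_of_mem_level r hZ hacyc k hu huZ
  have : C.card < Z.ncard := by
    rw [← Set.ncard_coe_finset]
    refine Set.ncard_lt_ncard ⟨h2, fun h => ?_⟩
    rcases h4 x (h hx) y (h hy) with h | h
    exacts [hxy h, hyx h]
  lia

/-- The levels decrease, and once two consecutive ones agree they are constant. Each strict step
loses a vertex, so there are at most `Fintype.card V` of them. -/
theorem level_card_succ : level r (Fintype.card V + 1) = level r (Fintype.card V) := by
  have key : ∀ k, level r (k + 1) = level r k ∨ (level r k).ncard + k ≤ Fintype.card V := by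
    intro k
    induction k with
    | zero =>
      right
      rw [← Nat.card_eq_fintype_card]
      exact Set.ncard_le_card _
    | succ k ih =>
      by_cases h : level r (k + 1) = level r k
      · left
        ext j
        change (∃ i ∈ level r (k + 1), r i j) ↔ (∃ i ∈ level r k, r i j)
        rw [h]
      · have h1 := ih.resolve_left h
        have := Set.ncard_lt_ncard ((level_succ_subset r k).ssubset_of_ne h)
        right; lia
  rcases key (Fintype.card V) with h | h
  · exact h
  · have h0 : level r (Fintype.card V) = ∅ := (Set.ncard_eq_zero (Set.toFinite _)).1 (by lia)
    rw [h0]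
    exact Set.subset_eq_empty ((level_succ_subset r _).trans h0.subset) rfl

theorem exists_mem_level_card {j : V} (hj : j ∈ level r (Fintype.card V)) :
    ∃ i ∈ level r (Fintype.card V), r i j := by
  rw [← level_card_succ] at hj
  exact hj

theorem mem_level_card_of_rel {i j : V} (hi : i ∈ level r (Fintype.card V)) (hij : r i j) :
    j ∈ level r (Fintype.card V) := by
  rw [← level_card_succ]
  exact ⟨i, hi, hij⟩

/-- If a long walk ends somewhere, then some vertex lies on long walks in both directions. -/
theorem exists_mem_level_inter (h : (level r (Fintype.card V)).Nonempty) :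
    (level r (Fintype.card V) ∩ level (Function.swap r) (Fintype.card V)).Nonempty := by
  -- The stable level contains a predecessor of each of its elements. Stepping back inside it
  -- lengthens the forward walk by one each time.
  have : ∀ k, (level r (Fintype.card V) ∩ level (Function.swap r) k).Nonempty := by
    intro k
    induction k with
    | zero => exact ⟨_, h.some_mem, trivial⟩
    | succ k ih =>
      obtain ⟨z, hz, hz'⟩ := ih
      obtain ⟨i, hi, hij⟩ := exists_mem_level_card r hz
      exact ⟨i, hi, z, hz', hij⟩
  exact this _

end Levels

/-! ### Nonnegative integer matrices without zero rows. -/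

section NonnegativeMatrices

open Matrix

/-- The kernels of the powers of an endomorphism that is not nilpotent stabilise before the dimension. -/
theorem pow_finrank_sub_one_eq_zero {k W : Type*} [Field k] [AddCommGroup W] [Module k W]
    [FiniteDimensional k W] (f : Module.End k W) (hf : ∀ m, f ^ m ≠ 0) {z : W} {t : ℕ}
    (hz : (f ^ t) z = 0) : (f ^ (Module.finrank k W - 1)) z = 0 := by
  -- On the kernel of `f ^ t` the map `f` is nilpotent, so the dimension of that kernel bounds its
  -- index. The kernel is proper because `f ^ t ≠ 0`, which gains the unit.
  let g : Module.End k (LinearMap.ker (f ^ t)) := f.restrict fun x hx => by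
    rw [LinearMap.mem_ker, ← Module.End.mul_apply, (Commute.self_pow f t).symm.eq,
      Module.End.mul_apply, LinearMap.mem_ker.1 hx, map_zero]
  have hg : ∀ (d : ℕ) (x : LinearMap.ker (f ^ t)), (((g ^ d) x : LinearMap.ker (f ^ t)) : W) =
      (f ^ d) x := by
    intro d
    induction d with
    | zero => intro x; rfl
    | succ d ih =>
      intro x
      rw [pow_succ, pow_succ, Module.End.mul_apply, Module.End.mul_apply, ih]
      rfl
  have h1 : (⟨z, hz⟩ : LinearMap.ker (f ^ t)) ∈ LinearMap.ker (g ^ t) := by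
    rw [LinearMap.mem_ker, Subtype.ext_iff, hg]
    exact hz
  have h2 := Module.End.ker_pow_le_ker_pow_finrank g t h1
  rw [LinearMap.mem_ker, Subtype.ext_iff, hg] at h2
  have h3 : Module.finrank k (LinearMap.ker (f ^ t)) < Module.finrank k W := by
    apply Submodule.finrank_lt
    rw [Ne, LinearMap.ker_eq_top]
    exact hf t
  obtain ⟨c, hc⟩ := Nat.exists_eq_add_of_le (Nat.le_sub_one_of_lt h3)
  rw [hc, add_comm, pow_add, Module.End.mul_apply]
  exact (congrArg _ h2).trans (map_zero _)

variable {H : Type v} [Fintype H] [DecidableEq H]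

/-- The row sums of all powers stay positive, so `M` is not nilpotent when the index set is
nonempty. -/
theorem one_le_pow_mulVec_one (M : Matrix H H ℤ) (hM : ∀ i j, 0 ≤ M i j)
    (hrow : ∀ i, ∃ j, M i j ≠ 0) (m : ℕ) (i : H) : 1 ≤ ((M ^ m) *ᵥ 1) i := by
  induction m generalizing i with
  | zero => simp
  | succ m ih =>
    rw [pow_succ', ← mulVec_mulVec]
    obtain ⟨j, hj⟩ := hrow i
    calc 1 ≤ M i j := by have := hM i j; lia
      _ ≤ M i j * ((M ^ m) *ᵥ 1) j := le_mul_of_one_le_right (hM i j) (ih j)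
      _ ≤ _ := Finset.single_le_sum (f := fun j => M i j * ((M ^ m) *ᵥ 1) j)
        (fun k _ => mul_nonneg (hM i k) (zero_le_one.trans (ih k))) (Finset.mem_univ j)

/-- Over `ℚ` the operator `y ↦ y M` is not nilpotent, by positivity of the row sums, so
`pow_finrank_sub_one_eq_zero` applies to it. -/
theorem vecMul_pow_card_sub_one_eq_zero (M : Matrix H H ℤ) (hM : ∀ i j, 0 ≤ M i j)
    (hrow : ∀ i, ∃ j, M i j ≠ 0) {z : H → ℤ} {t : ℕ} (hz : z ᵥ* M ^ t = 0) :
    z ᵥ* M ^ (Fintype.card H - 1) = 0 := by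
  cases isEmpty_or_nonempty H
  · exact Subsingleton.elim _ _
  let c : ℤ →+* ℚ := Int.castRingHom ℚ
  let f : Module.End ℚ (H → ℚ) := (c.mapMatrix M).vecMulLinear
  have hf : ∀ (m : ℕ) (y : H → ℚ), (f ^ m) y = y ᵥ* c.mapMatrix (M ^ m) := by
    intro m
    induction m with
    | zero => intro y; simp
    | succ m ih =>
      intro y
      rw [pow_succ', Module.End.mul_apply, ih, pow_succ, map_mul, ← vecMul_vecMul]
      rfl
  have hcast : ∀ m, (f ^ m) (c ∘ z) = c ∘ (z ᵥ* M ^ m) := by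
    intro m
    rw [hf]
    ext i
    exact (RingHom.map_vecMul c (M ^ m) z i).symm
  have h := pow_finrank_sub_one_eq_zero f (fun m h0 => ?_) (z := c ∘ z) (t := t) (by
    rw [hcast, hz]; ext i; simp)
  · rw [hcast, Module.finrank_fintype_fun_eq_card] at h
    ext i
    exact Int.cast_injective (congrFun h i)
  · have h1 : M ^ m = 0 := by
      ext i j
      have h2 := hf m (Pi.single i 1)
      rw [h0] at h2
      have h3 := congrFun h2 j
      simp [c] at h3
      exact_mod_cast h3.symm
    have h2 := one_le_pow_mulVec_one M hM hrow m (Classical.arbitrary H)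
    rw [h1] at h2
    simp at h2

end NonnegativeMatrices

/-! ### Transport of vectors by a nonnegative matrix, and the bound `n - 3`. -/

section Transfer

open Matrix

variable {V : Type v} [Fintype V] (T : Matrix V V ℤ)

/-- The relation given by the nonzero entries of a matrix. -/
def EntryRel (i j : V) : Prop := T i j ≠ 0

variable {T}

theorem vecMul_mem_level {k : ℕ} {v : V → ℤ} (hv : ∀ i, v i ≠ 0 → i ∈ level (EntryRel T) k) :
    ∀ i, (v ᵥ* T) i ≠ 0 → i ∈ level (EntryRel T) (k + 1) := by
  intro i hi
  obtain ⟨j, -, hj⟩ := Finset.exists_ne_zero_of_sum_ne_zero hi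
  exact ⟨j, hv j (left_ne_zero_of_mul hj), right_ne_zero_of_mul hj⟩

theorem vecMul_notMem_level {k : ℕ} {v : V → ℤ}
    (hv : ∀ i, v i ≠ 0 → i ∉ level (Function.swap (EntryRel T)) (k + 1)) :
    ∀ i, (v ᵥ* T) i ≠ 0 → i ∉ level (Function.swap (EntryRel T)) k := by
  intro i hi hik
  obtain ⟨j, -, hj⟩ := Finset.exists_ne_zero_of_sum_ne_zero hi
  exact hv j (left_ne_zero_of_mul hj) ⟨i, hik, right_ne_zero_of_mul hj⟩

variable (T) in
/-- The vertices that lie on arbitrarily long walks in both directions. -/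
def core : Set V := level (EntryRel T) (Fintype.card V) ∩
  level (Function.swap (EntryRel T)) (Fintype.card V)

theorem pred_mem_of_mem_notMem_level {i j : V} (hij : EntryRel T i j)
    (hj : j ∈ (level (EntryRel T) (Fintype.card V))ᶜ) :
    i ∈ (level (EntryRel T) (Fintype.card V))ᶜ :=
  fun hi => hj (mem_level_card_of_rel _ hi hij)

/-- This says that the diagonal block at the core has no zero row. Stability of the reversed level
provides a successor, and stability of the direct level keeps it in the core. -/
theorem exists_core_of_mem_core {i : V} (hi : i ∈ core T) : ∃ j ∈ core T, T i j ≠ 0 := by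
  obtain ⟨j, hj, hij⟩ := exists_mem_level_card (Function.swap (EntryRel T)) hi.2
  exact ⟨j, ⟨mem_level_card_of_rel _ hi.1 hij, hj⟩, hij⟩

variable [DecidableEq V]

theorem vecMul_pow_mem_level {k : ℕ} {v : V → ℤ} (hv : ∀ i, v i ≠ 0 → i ∈ level (EntryRel T) k)
    (m : ℕ) : ∀ i, (v ᵥ* T ^ m) i ≠ 0 → i ∈ level (EntryRel T) (k + m) := by
  induction m with
  | zero => simpa using hv
  | succ m ih =>
    rw [pow_succ, ← vecMul_vecMul]
    exact vecMul_mem_level ih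

theorem vecMul_pow_notMem_level {k : ℕ} (m : ℕ) {v : V → ℤ}
    (hv : ∀ i, v i ≠ 0 → i ∉ level (Function.swap (EntryRel T)) (k + m)) :
    ∀ i, (v ᵥ* T ^ m) i ≠ 0 → i ∉ level (Function.swap (EntryRel T)) k := by
  induction m generalizing v with
  | zero => simpa using hv
  | succ m ih =>
    rw [pow_succ', ← vecMul_vecMul]
    exact ih (vecMul_notMem_level hv)

/-- On vectors supported on the vertices reached by long walks, the restriction to the core
intertwines the matrix with its diagonal block at the core. -/
theorem vecMul_pow_core [Fintype (core T)] {w : V → ℤ}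
    (hw : ∀ i, w i ≠ 0 → i ∈ level (EntryRel T) (Fintype.card V)) (m : ℕ) :
    (fun i : core T => (w ᵥ* T ^ m) i) =
      (fun i : core T => w i) ᵥ* (T.submatrix (↑) (↑) : Matrix (core T) (core T) ℤ) ^ m := by
  induction m with
  | zero => simp
  | succ m ih =>
    rw [pow_succ, pow_succ, ← vecMul_vecMul, ← vecMul_vecMul, ← ih]
    ext j
    change ∑ i, (w ᵥ* T ^ m) i * T i j = ∑ i : core T, (w ᵥ* T ^ m) i * T i j
    symm
    apply Finset.sum_of_injOn (fun i : core T => (i : V)) Subtype.val_injective.injOn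
    · simp
    · intro i _ hi
      by_contra h
      apply hi
      -- A nonzero term forces `i` into the core: the vector has a nonzero entry at `i`, so long
      -- walks end there, and `i` has an edge into the core, so long walks start there.
      have h1 : i ∈ level (EntryRel T) (Fintype.card V) :=
        level_antitone _ (Nat.le_add_right _ m)
          (vecMul_pow_mem_level hw m i (left_ne_zero_of_mul h))
      have h2 : i ∈ level (Function.swap (EntryRel T)) (Fintype.card V) :=
        mem_level_card_of_rel (Function.swap (EntryRel T)) j.2.2 (right_ne_zero_of_mul h)
      exact ⟨⟨i, h1, h2⟩, Finset.mem_coe.2 (Finset.mem_univ _), rfl⟩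
    · intros; rfl

/-- A vector `w` supported on the vertices reached by long walks that is killed by some power of a
nonnegative matrix leaves the core quickly. -/
theorem vecMul_pow_core_eq_zero (hT : ∀ i j, 0 ≤ T i j) {w : V → ℤ}
    (hw : ∀ i, w i ≠ 0 → i ∈ level (EntryRel T) (Fintype.card V)) {t : ℕ} (ht : w ᵥ* T ^ t = 0) :
    ∀ i ∈ core T, (w ᵥ* T ^ ((core T).ncard - 1)) i = 0 := by
  classical
  have := Fintype.ofFinite (core T)
  intro i hi
  have h := vecMul_pow_card_sub_one_eq_zero
    (T.submatrix (↑) (↑) : Matrix (core T) (core T) ℤ) (fun _ _ => hT _ _) (fun i => by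
      obtain ⟨j, hj, hij⟩ := exists_core_of_mem_core i.2
      exact ⟨⟨j, hj⟩, hij⟩) (t := t) (z := fun i : core T => w i) (by
      rw [← vecMul_pow_core hw, ht]; rfl)
  rw [← vecMul_pow_core hw, ← Nat.card_eq_fintype_card] at h
  exact congrFun h ⟨i, hi⟩

/-- If two vertices off the core are incomparable, then a vector supported off the sources and killed by
some power of the matrix is moved to the sinks by the power with exponent `#V - 3`. -/
theorem vecMul_pow_card_sub_three (hT : ∀ i j, 0 ≤ T i j) {x y : V}
    (hx : x ∉ core T) (hy : y ∉ core T) (hxy : ¬ Relation.ReflTransGen (EntryRel T) x y)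
    (hyx : ¬ Relation.ReflTransGen (EntryRel T) y x) {v : V → ℤ}
    (hv : ∀ i, v i ≠ 0 → i ∈ level (EntryRel T) 1) {t : ℕ} (ht : v ᵥ* T ^ t = 0) :
    ∀ i ∈ level (Function.swap (EntryRel T)) 1, (v ᵥ* T ^ (Fintype.card V - 3)) i = 0 := by
  set n := Fintype.card V with hn
  set B := level (EntryRel T) n with hB
  set A := level (Function.swap (EntryRel T)) n with hA
  have hcore : core T = B ∩ A := rfl
  have hU : ∀ i j, EntryRel T i j → j ∈ Bᶜ → i ∈ Bᶜ :=
    fun i j hij => pred_mem_of_mem_notMem_level hij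
  have hUc : ∀ z ∈ Bᶜ, ¬ Relation.TransGen (EntryRel T) z z :=
    fun z hz => not_transGen_self_of_notMem_level _ hz
  have hD : ∀ i j, Function.swap (EntryRel T) i j → j ∈ B \ A → i ∈ B \ A :=
    fun i j hij hj => ⟨mem_level_card_of_rel _ hj.1 hij,
      fun hi => hj.2 (mem_level_card_of_rel (Function.swap (EntryRel T)) hi hij)⟩
  have hDc : ∀ z ∈ B \ A, ¬ Relation.TransGen (Function.swap (EntryRel T)) z z :=
    fun z hz => not_transGen_self_of_notMem_level _ hz.2
  have hsum : Bᶜ.ncard + (B \ A).ncard + (core T).ncard = n := by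
    have h1 := Set.ncard_add_ncard_compl B
    have h2 := Set.ncard_inter_add_ncard_sdiff_eq_ncard B A
    rw [Nat.card_eq_fintype_card] at h1
    rw [hcore]
    lia
  -- Here `a` bounds the steps needed to leave `Bᶜ` and `d` those needed to pass through `B \ A` to
  -- the sinks. The slack `b` is spent in the first phase.
  have main : ∀ a d : ℕ, a + ((core T).ncard - 1) + d ≤ n - 3 →
      (∀ u ∈ Bᶜ, u ∉ level (EntryRel T) (a + 1)) →
      (∀ u ∈ B \ A, u ∉ level (Function.swap (EntryRel T)) (d + 1)) →
      ∀ i ∈ level (Function.swap (EntryRel T)) 1, (v ᵥ* T ^ (n - 3)) i = 0 := by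
    intro a d hle ha hd i hi
    obtain ⟨b, hb⟩ := Nat.exists_eq_add_of_le' hle
    have hw0 := vecMul_pow_mem_level hv (b + a)
    set w := v ᵥ* T ^ (b + a) with hwdef
    have hw : ∀ i, w i ≠ 0 → i ∈ B := fun i hi => by
      by_contra h
      exact ha i h (level_antitone _ (by lia) (hw0 i hi))
    have hwt : w ᵥ* T ^ t = 0 := by
      rw [hwdef, vecMul_vecMul, ← pow_add, add_comm, pow_add, ← vecMul_vecMul, ht, zero_vecMul]
    have h1 := vecMul_pow_core_eq_zero hT hw hwt
    have h2 := vecMul_pow_mem_level hw ((core T).ncard - 1)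
    set w' := w ᵥ* T ^ ((core T).ncard - 1) with hw'def
    have h3 : ∀ i, w' i ≠ 0 → i ∉ level (Function.swap (EntryRel T)) (1 + d) := fun i hi => by
      have hiB : i ∈ B := level_antitone _ (by lia) (h2 i hi)
      rw [add_comm]
      exact hd i ⟨hiB, fun hiA => hi (h1 i ⟨hiB, hiA⟩)⟩
    have h4 := vecMul_pow_notMem_level d h3
    by_contra h
    refine h4 i ?_ hi
    rwa [hw'def, hwdef, vecMul_vecMul, vecMul_vecMul, ← pow_add, ← pow_add,
      show b + a + ((core T).ncard - 1 + d) = n - 3 by lia]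
  have hU1 : ∀ u ∈ Bᶜ, ∀ k, u ∈ level (EntryRel T) k → k < Bᶜ.ncard :=
    fun u hu k hk => lt_ncard_of_mem_level _ hU hUc hk hu
  have hD1 : ∀ u ∈ B \ A, ∀ k, u ∈ level (Function.swap (EntryRel T)) k → k < (B \ A).ncard :=
    fun u hu k hk => lt_ncard_of_mem_level _ hD hDc hk hu
  rcases Set.eq_empty_or_nonempty (core T) with hc | hc
  · have hBe : B = ∅ := by
      by_contra h
      have := exists_mem_level_inter (EntryRel T) (Set.nonempty_iff_ne_empty.2 h)
      exact this.ne_empty hc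
    intro i hi
    by_contra h
    have h1 := vecMul_pow_mem_level hv (n - 3) i h
    obtain ⟨j, -, hij⟩ := hi
    -- One edge because `v` starts off the sources, `n - 3` edges from the power, and one edge
    -- because `i` is not a sink. The resulting chain would have at least `n` vertices, leaving no
    -- room for an incomparable pair.
    have h2 : j ∈ level (EntryRel T) (1 + (n - 3) + 1) := ⟨i, h1, hij⟩
    have h3 := succ_lt_ncard_of_mem_level _ hU hUc h2 (by rw [hBe]; simp) (x := x) (y := y)
      (by rw [hBe]; simp) (by rw [hBe]; simp) hxy hyx
    lia
  · have hcpos : 0 < (core T).ncard := (Set.ncard_pos (Set.toFinite _)).2 hc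
    -- If an acyclic part is empty, plain counting only gives `n - 2`. Then `x` and `y` both lie in
    -- the other acyclic part, where incomparability shortens the walks by one.
    rcases Set.eq_empty_or_nonempty Bᶜ with hUe | hUne
    · have hxD : x ∈ B \ A := by
        have : x ∈ B := by_contra fun h => (hUe ▸ h : x ∈ (∅ : Set V))
        exact ⟨this, fun h => hx ⟨this, h⟩⟩
      have hyD : y ∈ B \ A := by
        have : y ∈ B := by_contra fun h => (hUe ▸ h : y ∈ (∅ : Set V))
        exact ⟨this, fun h => hy ⟨this, h⟩⟩
      have hD2 : ∀ u ∈ B \ A, ∀ k, u ∈ level (Function.swap (EntryRel T)) k →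
          k + 1 < (B \ A).ncard := fun u hu k hk =>
        succ_lt_ncard_of_mem_level _ hD hDc hk hu hxD hyD
          (fun h => hyx (Relation.reflTransGen_swap.1 h))
          (fun h => hxy (Relation.reflTransGen_swap.1 h))
      have h0 := hD2 x hxD 0 trivial
      have hU0 : Bᶜ.ncard = 0 := by rw [hUe, Set.ncard_empty]
      refine main 0 ((B \ A).ncard - 2) (by lia) (by rw [hUe]; simp) fun u hu hk => ?_
      have := hD2 u hu _ hk
      lia
    · have hUp := (Set.ncard_pos (Set.toFinite _)).2 hUne
      rcases Set.eq_empty_or_nonempty (B \ A) with hDe | hDne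
      · have hxU : x ∈ Bᶜ := fun h => by
          have : x ∈ B \ A := ⟨h, fun h' => hx ⟨h, h'⟩⟩
          exact (hDe ▸ this : x ∈ (∅ : Set V))
        have hyU : y ∈ Bᶜ := fun h => by
          have : y ∈ B \ A := ⟨h, fun h' => hy ⟨h, h'⟩⟩
          exact (hDe ▸ this : y ∈ (∅ : Set V))
        have hU2 : ∀ u ∈ Bᶜ, ∀ k, u ∈ level (EntryRel T) k → k + 1 < Bᶜ.ncard := fun u hu k hk =>
          succ_lt_ncard_of_mem_level _ hU hUc hk hu hxU hyU hxy hyx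
        have h0 := hU2 x hxU 0 trivial
        have hD0 : (B \ A).ncard = 0 := by rw [hDe, Set.ncard_empty]
        refine main (Bᶜ.ncard - 2) 0 (by lia) (fun u hu hk => ?_) (by rw [hDe]; simp)
        have := hU2 u hu _ hk
        lia
      · have hDp := (Set.ncard_pos (Set.toFinite _)).2 hDne
        -- With three nonempty parts each contributes a `- 1`; incomparability plays no role here.
        refine main (Bᶜ.ncard - 1) ((B \ A).ncard - 1) (by lia) (fun u hu hk => ?_)
          fun u hu hk => ?_
        · have := hU1 u hu _ hk
          lia
        · have := hD1 u hu _ hk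
          lia

end Transfer

end RadSq

noncomputable section

namespace RadSq

/-! ### The ideal `J²` and the filtration of the path algebra by length. -/

section LengthFiltration

open Quiver

variable (K : Type u) [Field K] (Q : Type v) [Quiver.{w} Q] [Fintype Q] [DecidableEq Q]

/-- The span of the paths of length at least `d`. -/
def lengthFiltration (d : ℕ) : Submodule K (PathAlgebra K Q) :=
  Submodule.span K {x | ∃ (i j : Q) (p : Path i j), d ≤ p.length ∧ x = ofPath p 1}

variable {K Q}

theorem ofPath_mem_lengthFiltration {d : ℕ} {i j : Q} (p : Path i j) (hp : d ≤ p.length) :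
    (ofPath p 1 : PathAlgebra K Q) ∈ lengthFiltration K Q d :=
  Submodule.subset_span ⟨i, j, p, hp, rfl⟩

theorem lengthFiltration_zero : lengthFiltration K Q 0 = ⊤ := by
  rw [← span_ofPath]
  simp [lengthFiltration]

theorem ofPath_mul_of_ne {i j k l : Q} (h : j ≠ k) (p : Path i j) (q : Path k l) (a b : K) :
    (ofPath p a * ofPath q b : PathAlgebra K Q) = 0 := by
  funext i' l'
  rw [mul_apply, zero_apply]
  refine Finset.sum_eq_zero fun m _ => ?_
  by_cases hm : m = j
  · subst hm
    have : (ofPath q b : PathAlgebra K Q) m l' = 0 := by simp [ofPath, Pi.single_eq_of_ne h]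
    rw [this, map_zero]
  · have : (ofPath p a : PathAlgebra K Q) i' m = 0 := by
      by_cases hi : i' = i
      · subst hi
        simp [ofPath, Pi.single_eq_of_ne hm]
      · simp [ofPath, Pi.single_eq_of_ne hi]
    rw [this, map_zero, LinearMap.zero_apply]

theorem mul_mem_lengthFiltration {d e : ℕ} {x y : PathAlgebra K Q}
    (hx : x ∈ lengthFiltration K Q d) (hy : y ∈ lengthFiltration K Q e) :
    x * y ∈ lengthFiltration K Q (d + e) := by
  have h : lengthFiltration K Q d * lengthFiltration K Q e ≤ lengthFiltration K Q (d + e) := by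
    rw [lengthFiltration, lengthFiltration, Submodule.span_mul_span, Submodule.span_le]
    rintro _ ⟨_, ⟨i, j, p, hp, rfl⟩, _, ⟨k, l, q, hq, rfl⟩, rfl⟩
    by_cases hjk : j = k
    · subst hjk
      change ofPath p 1 * ofPath q 1 ∈ _
      rw [ofPath_mul, mul_one]
      exact ofPath_mem_lengthFiltration _ (by rw [Path.length_comp]; lia)
    · change ofPath p 1 * ofPath q 1 ∈ _
      rw [ofPath_mul_of_ne hjk]
      exact Submodule.zero_mem _
  exact h (Submodule.mul_mem_mul hx hy)

variable (K Q) in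
/-- The span of the paths of length at least `d`, as a two-sided ideal. -/
def lengthIdeal (d : ℕ) : TwoSidedIdeal (PathAlgebra K Q) :=
  TwoSidedIdeal.mk' (lengthFiltration K Q d) (Submodule.zero_mem _) (Submodule.add_mem _)
    (Submodule.neg_mem _)
    (fun {x y} hy => by
      have := mul_mem_lengthFiltration (d := 0) (x := x) (by rw [lengthFiltration_zero]; trivial) hy
      rwa [zero_add] at this)
    (fun {x y} hx => by
      have := mul_mem_lengthFiltration (e := 0) (y := y) hx (by rw [lengthFiltration_zero]; trivial)
      rwa [add_zero] at this)

theorem mem_lengthIdeal {d : ℕ} {x : PathAlgebra K Q} :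
    x ∈ lengthIdeal K Q d ↔ x ∈ lengthFiltration K Q d :=
  TwoSidedIdeal.mem_mk' ..

theorem arrowIdeal_le : arrowIdeal K Q ≤ lengthIdeal K Q 1 := by
  rw [arrowIdeal, TwoSidedIdeal.span_le]
  rintro _ ⟨i, j, a, rfl⟩
  exact mem_lengthIdeal.2 (ofPath_mem_lengthFiltration _ le_rfl)

/-- Lengths add under multiplication, and `J` lies in length at least one. This inclusion is what
allows the coefficients of trivial paths and arrows to descend to `A`. -/
theorem arrowIdealSq_le : arrowIdealSq K Q ≤ lengthIdeal K Q 2 := by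
  rw [arrowIdealSq, TwoSidedIdeal.span_le]
  rintro _ ⟨x, hx, y, hy, rfl⟩
  have h1 : x ∈ lengthFiltration K Q 1 := mem_lengthIdeal.1 (arrowIdeal_le hx)
  have h2 : y ∈ lengthFiltration K Q 1 := mem_lengthIdeal.1 (arrowIdeal_le hy)
  have h3 := mul_mem_lengthFiltration h1 h2
  rw [one_add_one_eq_two] at h3
  rw [SetLike.mem_coe, mem_lengthIdeal]
  exact h3

/-- A linear map on `K Q` that vanishes on the paths of length at least two vanishes on `J²`. -/
theorem vanish_on_arrowIdealSq {W : Type*} [AddCommGroup W] [Module K W]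
    (f : PathAlgebra K Q →ₗ[K] W)
    (hf : ∀ (i j : Q) (p : Path i j), 2 ≤ p.length → f (ofPath p 1) = 0) {x : PathAlgebra K Q}
    (hx : x ∈ arrowIdealSq K Q) : f x = 0 := by
  have h := mem_lengthIdeal.1 (arrowIdealSq_le hx)
  have h2 : lengthFiltration K Q 2 ≤ LinearMap.ker f := by
    rw [lengthFiltration, Submodule.span_le]
    rintro _ ⟨i, j, p, hp, rfl⟩
    exact hf i j p hp
  exact h2 h

end LengthFiltration

/-! ### Coefficients of paths. -/

section Coefficients

open Quiver

variable (K : Type u) [Field K] (Q : Type v) [Quiver.{w} Q] [Fintype Q] [DecidableEq Q]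

variable {Q} in
/-- The coefficient of a path, as a linear functional on the path algebra. -/
def pathCoeff {i j : Q} (p : Path i j) : PathAlgebra K Q →ₗ[K] K where
  toFun f := f i j p
  map_add' _ _ := rfl
  map_smul' _ _ := rfl

variable {Q}

theorem pathCoeff_apply {i j : Q} (p : Path i j) (f : PathAlgebra K Q) :
    pathCoeff K p f = f i j p := rfl

theorem pathCoeff_ofPath_self {i j : Q} (p : Path i j) (a : K) :
    pathCoeff K p (ofPath p a) = a := by
  rw [pathCoeff_apply]; simp [ofPath]

theorem pathCoeff_ofPath_of_ne {i j k l : Q} (p : Path i j) (q : Path k l) (a : K)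
    (h : ¬ ∃ (hi : k = i) (hj : l = j), q.cast hi hj = p) : pathCoeff K p (ofPath q a) = 0 := by
  by_cases hi : k = i
  · subst hi
    by_cases hj : l = j
    · subst hj
      have : q ≠ p := fun e => h ⟨rfl, rfl, e⟩
      rw [pathCoeff_apply]; simp [ofPath, Finsupp.single_eq_of_ne this.symm]
    · rw [pathCoeff_apply]; simp [ofPath, Pi.single_eq_of_ne (Ne.symm hj)]
  · rw [pathCoeff_apply]; simp [ofPath, Pi.single_eq_of_ne (Ne.symm hi)]

theorem pathCoeff_ofPath_of_length_ne {i j k l : Q} (p : Path i j) (q : Path k l) (a : K)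
    (h : q.length ≠ p.length) : pathCoeff K p (ofPath q a) = 0 := by
  refine pathCoeff_ofPath_of_ne K p q a ?_
  rintro ⟨rfl, rfl, rfl⟩
  exact h rfl

/-- A trivial path factors only as a product of trivial paths. This makes `eps` a ring homomorphism.
-/
theorem pathCoeff_nil_mul (i : Q) (x y : PathAlgebra K Q) :
    pathCoeff K (Path.nil : Path i i) (x * y) =
      pathCoeff K (Path.nil : Path i i) x * pathCoeff K (Path.nil : Path i i) y := by
  have hx : x ∈ Submodule.span K _ := (span_ofPath K (Q := Q)).symm ▸ Submodule.mem_top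
  have hy : y ∈ Submodule.span K _ := (span_ofPath K (Q := Q)).symm ▸ Submodule.mem_top
  induction hx, hy using Submodule.span_induction₂ with
  | zero_left y hy => simp
  | zero_right x hx => simp
  | add_left x y z _ _ _ h1 h2 => rw [add_mul, map_add, h1, h2, map_add, add_mul]
  | add_right x y z _ _ _ h1 h2 => rw [mul_add, map_add, h1, h2, map_add, mul_add]
  | smul_left r x y _ _ h => rw [smul_mul_assoc, map_smul, h, map_smul, smul_mul_assoc]
  | smul_right r x y _ _ h => rw [mul_smul_comm, map_smul, h, map_smul, mul_smul_comm]
  | mem_mem x y hx hy =>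
    obtain ⟨j, k, p, rfl⟩ := hx
    obtain ⟨l, m, q, rfl⟩ := hy
    by_cases hkl : k = l
    · subst hkl
      rw [ofPath_mul, mul_one]
      match p, q with
      | .nil, .nil =>
        by_cases h : j = i
        · subst h
          simp only [Path.comp_nil, pathCoeff_ofPath_self, mul_one]
        · rw [Path.comp_nil, pathCoeff_ofPath_of_ne, zero_mul]
          rintro ⟨h', -, -⟩
          exact h h'
      | p, .cons q b =>
        rw [pathCoeff_ofPath_of_length_ne _ _ (q.cons b), mul_zero, pathCoeff_ofPath_of_length_ne]
        · simp
        · simp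
      | .cons p b, q =>
        rw [pathCoeff_ofPath_of_length_ne _ _ (p.cons b), zero_mul, pathCoeff_ofPath_of_length_ne]
        · simp [Path.length_comp]
        · simp
    · rw [ofPath_mul_of_ne hkl, map_zero]
      by_cases hj : k = i
      · rw [pathCoeff_ofPath_of_ne _ _ q, mul_zero]
        rintro ⟨rfl, -, -⟩
        exact hkl hj
      · rw [pathCoeff_ofPath_of_ne _ _ p, zero_mul]
        rintro ⟨-, h, -⟩
        exact hj h

end Coefficients

/-! ### The basis and the multiplication table of `A`. -/

section Presentation

open Quiver

variable (K : Type u) [Field K] {Q : Type v} [Quiver.{w} Q] [Fintype Q] [DecidableEq Q]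

theorem toAlg_surjective : Function.Surjective (toAlg K Q) :=
  fun x => Quotient.inductionOn' x fun y => ⟨y, rfl⟩

theorem toAlg_eq_zero {x : PathAlgebra K Q} (hx : x ∈ arrowIdealSq K Q) : toAlg K Q x = 0 :=
  Quotient.sound' hx

/-- The linear map induced on `A` by a linear map on `K Q` that vanishes on the paths of length at least
two. -/
def liftAlg {W : Type*} [AddCommGroup W] [Module K W] (f : PathAlgebra K Q →ₗ[K] W)
    (hf : ∀ (i j : Q) (p : Path i j), 2 ≤ p.length → f (ofPath p 1) = 0) : Alg K Q →ₗ[K] W where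
  toFun := Quotient.lift (s := (arrowIdealSq K Q).ringCon.toSetoid) f fun x y h => by
    have h1 : x - y ∈ arrowIdealSq K Q := (TwoSidedIdeal.rel_iff _ _ _).1 h
    have h2 := vanish_on_arrowIdealSq f hf h1
    rwa [map_sub, sub_eq_zero] at h2
  map_add' x y := Quotient.inductionOn₂' x y fun x y => map_add f x y
  map_smul' c x := Quotient.inductionOn' x fun x => map_smul f c x

/-- The image in `A` of an arrow. -/
def arr {i j : Q} (a : i ⟶ j) : Alg K Q := toAlg K Q (ofPath a.toPath 1)

/-- The coefficient of the trivial path at `i`, a homomorphism from `A` to `K`. -/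
def eps (i : Q) : Alg K Q →+* K where
  toFun := liftAlg K (pathCoeff K (Path.nil : Path i i)) fun _ _ p hp =>
    pathCoeff_ofPath_of_length_ne K _ p 1 (by simp; lia)
  map_zero' := map_zero _
  map_add' := map_add _
  map_one' := by
    change pathCoeff K (Path.nil : Path i i) 1 = 1
    change (1 : PathAlgebra K Q) i i _ = 1
    rw [one_apply_same, Finsupp.single_eq_same]
  map_mul' x y := Quotient.inductionOn₂' x y fun x y => pathCoeff_nil_mul K i x y

/-- The coefficient of an arrow, a linear functional on `A`. -/
def arrCoeff {i j : Q} (a : i ⟶ j) : Alg K Q →ₗ[K] K :=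
  liftAlg K (pathCoeff K a.toPath) fun _ _ p hp =>
    pathCoeff_ofPath_of_length_ne K _ p 1 (by simp; lia)

theorem eps_smul (i : Q) (c : K) (x : Alg K Q) : eps K i (c • x) = c * eps K i x := by
  obtain ⟨y, rfl⟩ := toAlg_surjective K x
  exact map_smul (pathCoeff K (Path.nil : Path i i)) c y

theorem eps_idem_self (i : Q) : eps K i (idem K Q i) = 1 := pathCoeff_ofPath_self K _ _

theorem eps_idem_of_ne {i j : Q} (h : i ≠ j) : eps K i (idem K Q j) = 0 :=
  pathCoeff_ofPath_of_ne K _ _ _ fun ⟨h', _⟩ => h h'.symm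

theorem eps_arr (i : Q) {j k : Q} (a : j ⟶ k) : eps K i (arr K a) = 0 :=
  pathCoeff_ofPath_of_length_ne K _ _ _ (by simp)

theorem arrCoeff_idem {j k : Q} (a : j ⟶ k) (i : Q) : arrCoeff K a (idem K Q i) = 0 :=
  pathCoeff_ofPath_of_length_ne K _ _ _ (by simp)

theorem arrCoeff_arr_self {j k : Q} (a : j ⟶ k) : arrCoeff K a (arr K a) = 1 :=
  pathCoeff_ofPath_self K _ _

variable (Q) in
/-- The arrows of `Q`. -/
abbrev Arrow : Type (max v w) := Σ i j : Q, (i ⟶ j)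

theorem arrCoeff_arr_of_ne {a b : Arrow Q} (h : a ≠ b) : arrCoeff K a.2.2 (arr K b.2.2) = 0 := by
  refine pathCoeff_ofPath_of_ne K _ _ _ ?_
  obtain ⟨i, j, a⟩ := a
  obtain ⟨k, l, b⟩ := b
  dsimp only
  rintro ⟨rfl, rfl, h'⟩
  apply h
  have : b = a := by
    simpa [Hom.toPath] using h'
  rw [this]

theorem idem_mul_self (i : Q) : idem K Q i * idem K Q i = idem K Q i := by
  rw [idem, ← map_mul, ofPath_mul, mul_one, Path.comp_nil]

theorem idem_mul_of_ne {i j : Q} (h : i ≠ j) : idem K Q i * idem K Q j = 0 := by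
  rw [idem, idem, ← map_mul, ofPath_mul_of_ne h, map_zero]

theorem idem_mul_arr {i j : Q} (a : i ⟶ j) : idem K Q i * arr K a = arr K a := by
  rw [idem, arr, ← map_mul, ofPath_mul, mul_one, Path.nil_comp]

theorem idem_mul_arr_of_ne {i j k : Q} (h : i ≠ j) (a : j ⟶ k) : idem K Q i * arr K a = 0 := by
  rw [idem, arr, ← map_mul, ofPath_mul_of_ne h, map_zero]

theorem arr_mul_idem {i j : Q} (a : i ⟶ j) : arr K a * idem K Q j = arr K a := by
  rw [idem, arr, ← map_mul, ofPath_mul, mul_one, Path.comp_nil]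

theorem arr_mul_idem_of_ne {i j k : Q} (h : j ≠ k) (a : i ⟶ j) : arr K a * idem K Q k = 0 := by
  rw [idem, arr, ← map_mul, ofPath_mul_of_ne h, map_zero]

theorem arr_mul_arr {i j k l : Q} (a : i ⟶ j) (b : k ⟶ l) : arr K a * arr K b = 0 := by
  by_cases h : j = k
  · subst h
    rw [arr, arr, ← map_mul, ofPath_mul, mul_one]
    exact toAlg_eq_zero K (ofPath_mem_arrowIdealSq K Q _ (by simp))
  · rw [arr, arr, ← map_mul, ofPath_mul_of_ne h, map_zero]

theorem sum_idem : ∑ i, idem K Q i = 1 := by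
  rw [← map_one (toAlg K Q)]
  exact (map_sum (toAlg K Q) _ _).symm

instance [∀ i j : Q, Finite (i ⟶ j)] : Fintype (Arrow Q) := Fintype.ofFinite _

variable [Fintype (Arrow Q)]

/-- Both sides are linear, so it is enough to check paths; those of length at least two vanish in
`A`. -/
theorem eq_sum_add_sum (x : Alg K Q) : x = ∑ i, eps K i x • idem K Q i +
    ∑ a : Arrow Q, arrCoeff K a.2.2 x • arr K a.2.2 := by
  classical
  let π : PathAlgebra K Q →ₗ[K] Alg K Q :=
    { toFun := toAlg K Q
      map_add' := map_add _
      map_smul' := fun _ _ => rfl }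
  let f : Alg K Q →ₗ[K] Alg K Q :=
    { toFun := fun x => ∑ i, eps K i x • idem K Q i + ∑ a : Arrow Q, arrCoeff K a.2.2 x • arr K a.2.2
      map_add' := fun x y => by
        simp only [map_add, add_smul, Finset.sum_add_distrib]; abel
      map_smul' := fun c x => by
        simp only [eps_smul, map_smul, smul_eq_mul, mul_smul, RingHom.id_apply, smul_add,
          Finset.smul_sum] }
  have h : π = f ∘ₗ π := by
    refine LinearMap.ext_on (span_ofPath K) ?_
    rintro _ ⟨i, j, p, rfl⟩
    match p with
    | .nil =>
      change idem K Q i = ∑ k, eps K k (idem K Q i) • idem K Q k +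
        ∑ a : Arrow Q, arrCoeff K a.2.2 (idem K Q i) • arr K a.2.2
      rw [Finset.sum_eq_single i (fun k _ hk => by rw [eps_idem_of_ne K hk, zero_smul]) (by simp),
        eps_idem_self, one_smul, Finset.sum_eq_zero (fun a _ => by rw [arrCoeff_idem, zero_smul]),
        add_zero]
    | .cons .nil a =>
      change arr K a = ∑ k, eps K k (arr K a) • idem K Q k +
        ∑ b : Arrow Q, arrCoeff K b.2.2 (arr K a) • arr K b.2.2
      rw [Finset.sum_eq_zero (fun a _ => by rw [eps_arr, zero_smul]), zero_add,
        Finset.sum_eq_single (⟨_, _, a⟩ : Arrow Q) (fun b _ hb => by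
          rw [arrCoeff_arr_of_ne K hb (b := ⟨_, _, a⟩), zero_smul]) (by simp),
        arrCoeff_arr_self, one_smul]
    | .cons (.cons p a) b =>
      have : π (ofPath ((p.cons a).cons b) 1) = 0 :=
        toAlg_eq_zero K (ofPath_mem_arrowIdealSq K Q ((p.cons a).cons b) (by simp))
      rw [LinearMap.comp_apply, this, map_zero]
  obtain ⟨y, rfl⟩ := toAlg_surjective K x
  exact LinearMap.congr_fun h y

/-- As `J² = 0`, only the `e_j` component of `x` survives. Thus the right ideal generated by an
arrow is a line on which `A` acts through the vertex `j`. -/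
theorem arr_mul {i j : Q} (a : i ⟶ j) (x : Alg K Q) : arr K a * x = eps K j x • arr K a := by
  conv_lhs => rw [eq_sum_add_sum K x]
  rw [mul_add, Finset.mul_sum, Finset.mul_sum, Finset.sum_eq_single j, Finset.sum_eq_zero, add_zero,
    mul_smul_comm, arr_mul_idem]
  · intro b _
    rw [mul_smul_comm, arr_mul_arr, smul_zero]
  · intro k _ hk
    rw [mul_smul_comm, arr_mul_idem_of_ne K hk.symm, smul_zero]
  · simp

theorem mul_arr {i j : Q} (a : i ⟶ j) (x : Alg K Q) : x * arr K a = eps K i x • arr K a := by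
  conv_lhs => rw [eq_sum_add_sum K x]
  rw [add_mul, Finset.sum_mul, Finset.sum_mul, Finset.sum_eq_single i, Finset.sum_eq_zero, add_zero,
    smul_mul_assoc, idem_mul_arr]
  · intro b _
    rw [smul_mul_assoc, arr_mul_arr, smul_zero]
  · intro k _ hk
    rw [smul_mul_assoc, idem_mul_arr_of_ne K hk, smul_zero]
  · simp

theorem idem_mul (i : Q) (x : Alg K Q) : idem K Q i * x = eps K i x • idem K Q i +
    ∑ a : Arrow Q, if a.1 = i then arrCoeff K a.2.2 x • arr K a.2.2 else 0 := by
  conv_lhs => rw [eq_sum_add_sum K x]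
  rw [mul_add, Finset.mul_sum, Finset.mul_sum, Finset.sum_eq_single i, mul_smul_comm, idem_mul_self]
  · congr 1
    refine Finset.sum_congr rfl fun a _ => ?_
    split_ifs with h
    · subst h
      rw [mul_smul_comm, idem_mul_arr]
    · rw [mul_smul_comm, idem_mul_arr_of_ne K (Ne.symm h), smul_zero]
  · intro k _ hk
    rw [mul_smul_comm, idem_mul_of_ne K hk.symm, smul_zero]
  · simp

theorem mul_idem (i : Q) (x : Alg K Q) : x * idem K Q i = eps K i x • idem K Q i +
    ∑ a : Arrow Q, if a.2.1 = i then arrCoeff K a.2.2 x • arr K a.2.2 else 0 := by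
  conv_lhs => rw [eq_sum_add_sum K x]
  rw [add_mul, Finset.sum_mul, Finset.sum_mul, Finset.sum_eq_single i, smul_mul_assoc, idem_mul_self]
  · congr 1
    refine Finset.sum_congr rfl fun a _ => ?_
    split_ifs with h
    · subst h
      rw [smul_mul_assoc, arr_mul_idem]
    · rw [smul_mul_assoc, arr_mul_idem_of_ne K h, smul_zero]
  · intro k _ hk
    rw [smul_mul_assoc, idem_mul_of_ne K hk, smul_zero]
  · simp

end Presentation

end RadSq

noncomputable section

namespace RadSq

open MulOpposite

/-! ### Radicals, supports of syzygies and cosyzygies, and the heart. -/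

section RightModules

variable {K : Type u} [Field K] {Q : Type v} [Quiver.{w} Q] [Fintype Q] [DecidableEq Q]

section Action

variable {N : Type*} [AddCommGroup N] [Module (Alg K Q)ᵐᵒᵖ N]

theorem op_smul_op_smul (a b : Alg K Q) (x : N) : op a • op b • x = op (b * a) • x := by
  rw [← mul_smul, ← op_mul]

variable (K Q) in
/-- The elements of the right module `N` are annihilated by all arrows. -/
def KilledByArrows (N : Type*) [AddCommGroup N] [Module (Alg K Q)ᵐᵒᵖ N] : Prop :=
  ∀ (i j : Q) (a : i ⟶ j) (x : N), op (arr K a) • x = 0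

/-- The map `a ↦ x a`. -/
def orbitMap (x : N) : Alg K Q →+ N where
  toFun a := op a • x
  map_zero' := by rw [op_zero, zero_smul]
  map_add' a b := by rw [op_add, add_smul]

theorem orbitMap_apply (x : N) (a : Alg K Q) : orbitMap x a = op a • x := rfl

theorem op_smul_smul (c : K) (a : Alg K Q) (x : N) :
    op (c • a) • x = op (c • (1 : Alg K Q)) • op a • x := by
  rw [op_smul_op_smul, mul_smul_comm, mul_one]

theorem op_one_smul_op_one_smul (c d : K) (x : N) :
    op (c • (1 : Alg K Q)) • op (d • (1 : Alg K Q)) • x = op ((c * d) • (1 : Alg K Q)) • x := by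
  rw [← op_smul_smul, smul_smul]

variable (K Q N) in
/-- The submodule `N J` of the right module `N`. -/
def arrowRad : Submodule (Alg K Q)ᵐᵒᵖ N :=
  Submodule.span _ {y | ∃ (i j : Q) (a : i ⟶ j) (x : N), y = op (arr K a) • x}

variable (K N) in
/-- The part of `N J` at the vertex `j`. -/
def arrowRadAt (j : Q) : Submodule (Alg K Q)ᵐᵒᵖ N :=
  Submodule.span _ {y | ∃ (i : Q) (a : i ⟶ j) (x : N), y = op (arr K a) • x}

theorem arrowRadAt_le (j : Q) : arrowRadAt K N j ≤ arrowRad K Q N :=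
  Submodule.span_mono fun _ ⟨i, a, x, h⟩ => ⟨i, j, a, x, h⟩

theorem arrowRad_eq_bot (h : KilledByArrows K Q N) : arrowRad K Q N = ⊥ := by
  rw [arrowRad, Submodule.span_eq_bot]
  rintro _ ⟨i, j, a, x, rfl⟩
  exact h i j a x

variable [Fintype (Arrow Q)]

theorem op_mul_idem_smul (i : Q) (a : Alg K Q) (x : N) :
    op (a * idem K Q i) • x = op (eps K i a • idem K Q i) • x +
      ∑ b : Arrow Q, if b.2.1 = i then op (arrCoeff K b.2.2 a • arr K b.2.2) • x else 0 := by
  rw [mul_idem, ← orbitMap_apply, map_add, map_sum, orbitMap_apply]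
  congr 1
  refine Finset.sum_congr rfl fun b _ => ?_
  split_ifs
  · rfl
  · exact map_zero _

/-- The algebra acts by scalars on an element at the vertex `j` that is annihilated by all arrows. -/
theorem op_smul_of_killed {j : Q} {x : N} (hx : ∀ (k : Q) (a : j ⟶ k), op (arr K a) • x = 0)
    (hj : op (idem K Q j) • x = x) (a : Alg K Q) :
    op a • x = op (eps K j a • (1 : Alg K Q)) • x := by
  conv_lhs => rw [← hj, op_smul_op_smul, idem_mul, ← orbitMap_apply, map_add, map_sum,
    orbitMap_apply, op_smul_smul, hj]
  rw [Finset.sum_eq_zero, add_zero]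
  rintro ⟨i, k, b⟩ _
  dsimp only
  split_ifs with h
  · subst h
    rw [orbitMap_apply, op_smul_smul, hx, smul_zero]
  · exact map_zero _

theorem arr_smul_eq_zero_of_mem_arrowRad {x : N} (hx : x ∈ arrowRad K Q N) {i j : Q} (a : i ⟶ j) :
    op (arr K a) • x = 0 := by
  induction hx using Submodule.span_induction generalizing i j with
  | zero => exact smul_zero _
  | add x y _ _ h1 h2 => rw [smul_add, h1, h2, add_zero]
  | smul r x _ h =>
    obtain ⟨r, rfl⟩ := op_surjective r
    rw [op_smul_op_smul, mul_arr, op_smul_smul, h, smul_zero]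
  | mem x hx =>
    obtain ⟨_, _, b, y, rfl⟩ := hx
    rw [op_smul_op_smul, arr_mul_arr, op_zero, zero_smul]

/-- The radical is generated by elements at the ends of arrows, so it vanishes at sources. For this
reason syzygies involve only vertices that are not sources. -/
theorem idem_smul_eq_zero_of_mem_arrowRad {j : Q} (hj : ∀ i : Q, IsEmpty (i ⟶ j)) {x : N}
    (hx : x ∈ arrowRad K Q N) : op (idem K Q j) • x = 0 := by
  induction hx using Submodule.span_induction with
  | zero => exact smul_zero _
  | add x y _ _ h1 h2 => rw [smul_add, h1, h2, add_zero]
  | smul r x _ h =>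
    obtain ⟨r, rfl⟩ := op_surjective r
    rw [op_smul_op_smul, op_mul_idem_smul, op_smul_smul, h, smul_zero, zero_add]
    refine Finset.sum_eq_zero ?_
    rintro ⟨i, k, b⟩ _
    dsimp only
    split_ifs with h
    · subst h
      exact ((hj i).false b).elim
    · rfl
  | mem x hx =>
    obtain ⟨i, k, b, y, rfl⟩ := hx
    have : k ≠ j := fun h => (hj i).false (h ▸ b)
    rw [op_smul_op_smul, arr_mul_idem_of_ne K this, op_zero, zero_smul]

/-- In a projective module the elements at a vertex `i` that are killed by an arrow starting at `i` lie
in the radical. -/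
theorem idem_smul_mem_arrowRadAt [Module.Projective (Alg K Q)ᵐᵒᵖ N] {i j : Q} (a : i ⟶ j) {p : N}
    (hp : op (arr K a) • p = 0) : op (idem K Q i) • p ∈ arrowRadAt K N i := by
  obtain ⟨s, hs⟩ := (Module.projective_def (R := (Alg K Q)ᵐᵒᵖ) (P := N)).1 inferInstance
  -- The section `s` embeds the module in a free one, so `p a = 0` can be read in coordinates. As `a
  -- ≠ 0` in `A`, no coordinate has an `e_i` component; multiplication by `e_i` then leaves only
  -- arrows ending at `i`.
  have h1 : ∀ q, eps K i (unop (s p q)) = 0 := by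
    intro q
    have h2 : op (arr K a) • s p = 0 := by rw [← map_smul, hp, map_zero]
    have h3 : op (arr K a) * s p q = 0 := DFunLike.congr_fun h2 q
    have h4 : unop (s p q) * arr K a = 0 := op_injective (by rw [op_mul, op_unop, h3, op_zero])
    rw [mul_arr] at h4
    have h5 := congrArg (arrCoeff K a) h4
    rwa [map_smul, arrCoeff_arr_self, map_zero, smul_eq_mul, mul_one] at h5
  have h2 : p = (s p).sum fun q r => r • q := (hs p).symm
  rw [h2, Finsupp.smul_sum]
  refine Submodule.sum_mem _ fun q _ => ?_
  have h3 : (s p q) • q = op (unop (s p q)) • q := rfl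
  change op (idem K Q i) • s p q • q ∈ _
  rw [h3, op_smul_op_smul, op_mul_idem_smul, h1, zero_smul, op_zero, zero_smul, zero_add]
  refine Submodule.sum_mem _ ?_
  rintro ⟨k, l, b⟩ _
  dsimp only
  split_ifs with h
  · subst h
    rw [op_smul_smul]
    exact Submodule.smul_mem _ _ (Submodule.subset_span ⟨k, b, q, rfl⟩)
  · exact Submodule.zero_mem _

/-- A superfluous submodule lies in the radical. -/
theorem le_arrowRad_of_superfluous (L : Submodule (Alg K Q)ᵐᵒᵖ N)
    (hL : ∀ C : Submodule (Alg K Q)ᵐᵒᵖ N, C ⊔ L = ⊤ → C = ⊤) : L ≤ arrowRad K Q N := by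
  intro p hp
  have key : ∀ i, op (idem K Q i) • p ∈ arrowRad K Q N := by
    intro i
    by_contra hpi
    let _ : Module K (N ⧸ arrowRad K Q N) :=
      Module.compHom _ (algebraMap K (Alg K Q)ᵐᵒᵖ)
    have hK : ∀ (c : K) (x : N ⧸ arrowRad K Q N), c • x = op (c • (1 : Alg K Q)) • x := by
      intro c x
      change algebraMap K (Alg K Q)ᵐᵒᵖ c • x = _
      rw [Algebra.algebraMap_eq_smul_one]
      rfl
    let π := (arrowRad K Q N).mkQ
    have hne : π (op (idem K Q i) • p) ≠ 0 := fun h => hpi ((Submodule.Quotient.mk_eq_zero _).1 h)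
    -- The map `x ↦ l (x e_i)` transforms through `eps K i`, so its kernel `C` is a submodule. It
    -- has codimension one and misses `p ∈ L`, so `C` and `L` span `N` although `C` is proper,
    -- contrary to superfluity.
    obtain ⟨l, hl⟩ : ∃ l : Module.Dual K (N ⧸ arrowRad K Q N), l (π (op (idem K Q i) • p)) ≠ 0 := by
      by_contra! hcon
      exact hne ((Module.forall_dual_apply_eq_zero_iff K _).1 hcon)
    let m : N →+ K := (l.toAddMonoidHom.comp π.toAddMonoidHom).comp
      (DistribSMul.toAddMonoidHom N (op (idem K Q i)))
    have hm : ∀ x, m x = l (π (op (idem K Q i) • x)) := fun _ => rfl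
    have hmr : ∀ (a : Alg K Q) x, m (op a • x) = eps K i a * m x := by
      intro a x
      rw [hm, hm, op_smul_op_smul, op_mul_idem_smul, map_add, op_smul_smul, map_smul π, ← hK,
        map_sum π, Finset.sum_eq_zero, add_zero, map_smul, smul_eq_mul]
      rintro ⟨k, j, b⟩ _
      dsimp only
      split_ifs
      · rw [op_smul_smul]
        exact (Submodule.Quotient.mk_eq_zero _).2
          (Submodule.smul_mem _ _ (Submodule.subset_span ⟨k, j, b, x, rfl⟩))
      · exact map_zero _
    let C : Submodule (Alg K Q)ᵐᵒᵖ N :=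
      { carrier := {x | m x = 0}
        add_mem' := fun {x y} hx hy => by
          change m (x + y) = 0
          rw [map_add, show m x = 0 from hx, show m y = 0 from hy, add_zero]
        zero_mem' := map_zero m
        smul_mem' := fun r x hx => by
          obtain ⟨r, rfl⟩ := op_surjective r
          change m (op r • x) = 0
          rw [hmr, show m x = 0 from hx, mul_zero] }
    have hmp : m p ≠ 0 := hl
    have hC : C = ⊤ := by
      apply hL
      rw [eq_top_iff]
      intro x _
      rw [Submodule.mem_sup]
      refine ⟨x - op ((m x / m p) • (1 : Alg K Q)) • p, ?_, _, L.smul_mem _ hp, sub_add_cancel _ _⟩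
      change m _ = 0
      rw [map_sub, hmr, eps_smul, map_one, mul_one, div_mul_cancel₀ _ hmp, sub_self]
    have : p ∈ C := hC ▸ Submodule.mem_top
    exact hmp this
  have h1 : p = ∑ i, op (idem K Q i) • p := by
    simp_rw [← orbitMap_apply]
    rw [← map_sum, sum_idem, orbitMap_apply, op_one, one_smul]
  rw [h1]
  exact Submodule.sum_mem _ fun i _ => key i

end Action

theorem A0_killedByArrows : KilledByArrows K Q (A0 K Q) := by
  intro i j a x
  obtain ⟨x, rfl⟩ := Submodule.Quotient.mk_surjective _ x
  refine (Submodule.Quotient.mk_eq_zero _).2 (Submodule.subset_span ?_)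
  obtain ⟨y, rfl⟩ := toAlg_surjective K x
  exact ⟨y * ofPath a.toPath 1,
    TwoSidedIdeal.mul_mem_left _ _ _ (TwoSidedIdeal.subset_span ⟨i, j, a, rfl⟩), map_mul _ _ _⟩

theorem mem_support_A0 (i : Q) : i ∈ support (A0 K Q) := by
  refine ⟨Submodule.Quotient.mk 1, fun h => ?_⟩
  have h1 := (Submodule.Quotient.mk_eq_zero _).1 h
  have h2 : ∀ x ∈ Submodule.span (Alg K Q)ᵐᵒᵖ
      (toAlg K Q '' (arrowIdeal K Q : Set (PathAlgebra K Q))), eps K i x = 0 := by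
    intro x hx
    induction hx using Submodule.span_induction with
    | zero => exact map_zero _
    | add x y _ _ h1 h2 => rw [map_add, h1, h2, add_zero]
    | smul r x _ h =>
      change eps K i (x * unop r) = 0
      rw [map_mul, h, zero_mul]
    | mem x hx =>
      obtain ⟨y, hy, rfl⟩ := hx
      have h3 := mem_lengthIdeal.1 (arrowIdeal_le hy)
      have h4 : lengthFiltration K Q 1 ≤
          LinearMap.ker (pathCoeff K (Quiver.Path.nil : Quiver.Path i i)) := by
        rw [lengthFiltration, Submodule.span_le]
        rintro _ ⟨k, l, p, hp, rfl⟩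
        exact pathCoeff_ofPath_of_length_ne K _ p 1 (by simp; lia)
      exact h4 h3
  have h3 := h2 _ h1
  change eps K i (1 * idem K Q i) = 0 at h3
  rw [one_mul, eps_idem_self] at h3
  exact one_ne_zero h3

variable [∀ i j : Q, Finite (i ⟶ j)]

theorem mem_arrowRad_of_mem_ker {P M : Type (max u v w)} [AddCommGroup P] [Module (Alg K Q)ᵐᵒᵖ P]
    [AddCommGroup M] [Module (Alg K Q)ᵐᵒᵖ M] {f : P →ₗ[(Alg K Q)ᵐᵒᵖ] M} (hf : IsProjectiveCover f)
    {x : P} (hx : f x = 0) : x ∈ arrowRad K Q P :=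
  le_arrowRad_of_superfluous (LinearMap.ker f) hf.superfluous hx


theorem syzygy_killedByArrows (M : FGModuleCat.{max u v w} (Alg K Q)ᵐᵒᵖ) :
    KilledByArrows K Q (syzygy M) := by
  rintro i j a ⟨x, hx⟩
  apply Subtype.ext
  exact arr_smul_eq_zero_of_mem_arrowRad
    (mem_arrowRad_of_mem_ker (exists_projectiveCover M).choose_spec.choose_spec hx) a

/-- Lift an element `m` with `m e_i ≠ 0` to `q` in the projective cover. Then `q a` is in the
syzygy, at the vertex `j`. If it were zero, `q e_i` would be in the radical, which maps to zero
because `M` is killed by arrows. -/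
theorem mem_support_syzygy {M : FGModuleCat.{max u v w} (Alg K Q)ᵐᵒᵖ} (hM : KilledByArrows K Q M)
    {i j : Q} (a : i ⟶ j) (hi : i ∈ support M) : j ∈ support (syzygy M) := by
  obtain ⟨m, hm⟩ := hi
  have hf := (exists_projectiveCover M).choose_spec.choose_spec
  set f := (exists_projectiveCover M).choose_spec.choose with hfdef
  have := hf.projective
  obtain ⟨q, rfl⟩ := hf.surjective m
  have hz : f (op (arr K a) • q) = 0 := by rw [map_smul, hM]
  refine ⟨⟨op (arr K a) • q, hz⟩, fun h => ?_⟩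
  have h1 : op (idem K Q j) • op (arr K a) • q = 0 := congrArg Subtype.val h
  rw [op_smul_op_smul, arr_mul_idem] at h1
  have h2 := arrowRadAt_le _ (idem_smul_mem_arrowRadAt a h1)
  have h3 : arrowRad K Q (exists_projectiveCover M).choose ≤ LinearMap.ker f := by
    rw [arrowRad, Submodule.span_le]
    rintro _ ⟨k, l, b, x, rfl⟩
    change f _ = 0
    rw [map_smul, hM]
  apply hm
  rw [← map_smul]
  exact h3 h2

/-- An element `x a` of the injective envelope generates a submodule consisting of its scalar
multiples. If it is nonzero, this submodule meets the image of `M` by essentiality, so `x a` lies in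
that image. -/
theorem cosyzygy_killedByArrows (M : FGModuleCat.{max u v w} (Alg K Q)ᵐᵒᵖ) :
    KilledByArrows K Q (cosyzygy K M) := by
  have hf := (exists_injectiveEnvelope K M).choose_spec.choose_spec
  set f := (exists_injectiveEnvelope K M).choose_spec.choose with hfdef
  intro i j a x
  obtain ⟨x, rfl⟩ := Submodule.Quotient.mk_surjective _ x
  change Submodule.Quotient.mk (op (arr K a) • x) = _
  refine (Submodule.Quotient.mk_eq_zero _).2 ?_
  set z := op (arr K a) • x with hz
  by_cases hz0 : z = 0
  · rw [hz0]
    exact Submodule.zero_mem _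
  have h1 : Submodule.span (Alg K Q)ᵐᵒᵖ {z} ⊓ LinearMap.range f ≠ ⊥ := by
    intro h
    have := hf.essential _ h
    rw [Submodule.span_singleton_eq_bot] at this
    exact hz0 this
  obtain ⟨y, ⟨hy1, hy2⟩, hy0⟩ := Submodule.exists_mem_ne_zero_of_ne_bot h1
  obtain ⟨r, rfl⟩ := Submodule.mem_span_singleton.1 hy1
  obtain ⟨r, rfl⟩ := op_surjective r
  have h2 : op r • z = op (eps K j r • (1 : Alg K Q)) • z := by
    rw [hz, op_smul_op_smul, arr_mul, op_smul_smul]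
  have h3 : eps K j r ≠ 0 := fun h => hy0 (by rw [h2, h, zero_smul, op_zero, zero_smul])
  have h4 : z = op ((eps K j r)⁻¹ • (1 : Alg K Q)) • op r • z := by
    rw [h2, op_one_smul_op_one_smul, inv_mul_cancel₀ h3, one_smul, op_one, one_smul]
  rw [h4]
  exact Submodule.smul_mem _ _ hy2

theorem mem_support_cosyzygy {M : FGModuleCat.{max u v w} (Alg K Q)ᵐᵒᵖ} (hM : KilledByArrows K Q M)
    {i j : Q} (a : i ⟶ j) (hj : j ∈ support M) : i ∈ support (cosyzygy K M) := by
  have hf := (exists_injectiveEnvelope K M).choose_spec.choose_spec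
  set f := (exists_injectiveEnvelope K M).choose_spec.choose with hfdef
  obtain ⟨m, hm⟩ := hj
  set x := f (op (idem K Q j) • m) with hx
  have hx0 : x ≠ 0 := fun h => hm (hf.injective (by rw [← hx, h, map_zero]))
  have hxr : ∀ b : Alg K Q, op b • x = op (eps K j b • (1 : Alg K Q)) • x := by
    apply op_smul_of_killed
    · intro k b
      rw [hx, ← map_smul, hM, map_zero]
    · rw [hx, ← map_smul, op_smul_op_smul, idem_mul_self]
  -- The ideal generated by the arrow is the line `K a`, on which `a ↦ x` is a module map.
  -- Injectivity extends it to `A`, and the image `y` of `1` satisfies `y a = x`. If `y e_i` came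
  -- from `M`, then `x = (y e_i) a` would vanish.
  let I : Ideal (Alg K Q)ᵐᵒᵖ := Ideal.span {op (arr K a)}
  have hI : ∀ y : I, ∃ c : K, (y : (Alg K Q)ᵐᵒᵖ) = op (c • arr K a) := by
    rintro ⟨y, hy⟩
    obtain ⟨r, rfl⟩ := Ideal.mem_span_singleton'.1 hy
    obtain ⟨r, rfl⟩ := op_surjective r
    exact ⟨eps K j r, by rw [← arr_mul, op_mul]⟩
  let g : I →ₗ[(Alg K Q)ᵐᵒᵖ] (exists_injectiveEnvelope K M).choose :=
    { toFun := fun y => op (arrCoeff K a (unop y) • (1 : Alg K Q)) • x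
      map_add' := fun y z => by
        rw [Submodule.coe_add, unop_add, map_add, add_smul, op_add, add_smul]
      map_smul' := fun r y => by
        obtain ⟨r, rfl⟩ := op_surjective r
        obtain ⟨c, hc⟩ := hI y
        have h : arrCoeff K a (unop ((op r • y : I) : (Alg K Q)ᵐᵒᵖ)) =
            arrCoeff K a (unop (y : (Alg K Q)ᵐᵒᵖ)) * eps K j r := by
          rw [Submodule.coe_smul, hc, smul_eq_mul, ← op_mul, unop_op, unop_op, smul_mul_assoc,
            arr_mul, map_smul, map_smul, map_smul, arrCoeff_arr_self, smul_eq_mul, smul_eq_mul,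
            smul_eq_mul, mul_one, mul_one]
        rw [RingHom.id_apply, h, op_smul_op_smul, smul_mul_assoc, one_mul, op_smul_smul _ r, hxr r,
          op_one_smul_op_one_smul] }
  obtain ⟨g', hg'⟩ := Module.Baer.of_injective hf.injective_module I g
  have hya : op (arr K a) • g' 1 = x := by
    rw [← map_smul, smul_eq_mul, mul_one, hg' _ (Ideal.mem_span_singleton_self _)]
    change op (arrCoeff K a (arr K a) • (1 : Alg K Q)) • x = x
    rw [arrCoeff_arr_self, one_smul, op_one, one_smul]
  refine ⟨Submodule.Quotient.mk (g' 1), fun h => hx0 ?_⟩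
  change Submodule.Quotient.mk (op (idem K Q i) • g' 1) = _ at h
  obtain ⟨y, hy⟩ := (Submodule.Quotient.mk_eq_zero _).1 h
  rw [← hya, ← idem_mul_arr, ← op_smul_op_smul, ← hy, ← map_smul, hM, map_zero]

variable (Q) in
/-- There is an arrow from `i` to `j`. -/
def ArrowRel (i j : Q) : Prop := Nonempty (i ⟶ j)

/-- Being killed by arrows is carried along because `mem_support_syzygy` requires it at each stage.
A lower bound on the support is enough for finding vertices in the heart. -/
theorem level_subset_support_syzygy (k : ℕ) :
    KilledByArrows K Q (syzygy^[k] (A0 K Q)) ∧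
      level (ArrowRel Q) k ⊆ support (syzygy^[k] (A0 K Q)) := by
  induction k with
  | zero => exact ⟨A0_killedByArrows, fun i _ => mem_support_A0 i⟩
  | succ k ih =>
    rw [Function.iterate_succ_apply']
    exact ⟨syzygy_killedByArrows _, fun j ⟨i, hi, ⟨a⟩⟩ => mem_support_syzygy ih.1 a (ih.2 hi)⟩

theorem level_subset_support_cosyzygy (k : ℕ) :
    KilledByArrows K Q ((cosyzygy K)^[k] (A0 K Q)) ∧
      level (Function.swap (ArrowRel Q)) k ⊆ support ((cosyzygy K)^[k] (A0 K Q)) := by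
  induction k with
  | zero => exact ⟨A0_killedByArrows, fun i _ => mem_support_A0 i⟩
  | succ k ih =>
    rw [Function.iterate_succ_apply']
    exact ⟨cosyzygy_killedByArrows _, fun j ⟨i, hi, ⟨a⟩⟩ => mem_support_cosyzygy ih.1 a (ih.2 hi)⟩

variable (K Q) in
theorem level_inter_subset_heart : level (ArrowRel Q) (Fintype.card Q) ∩
    level (Function.swap (ArrowRel Q)) (Fintype.card Q) ⊆ heart K Q :=
  Set.inter_subset_inter (level_subset_support_syzygy _).2 (level_subset_support_cosyzygy _).2

end RightModules

end RadSq

noncomputable section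

namespace RadSq

open MulOpposite Matrix

/-! ### Finite direct sums in `K₀`. -/

section StableGroup

variable {R : Type v} [Ring R]

theorem cls_eq_zero_of_subsingleton (M : FGModuleCat.{v} R) [Subsingleton M] : cls M = 0 :=
  cls_projective M inferInstance

theorem cls_congr {M N : FGModuleCat.{v} R} (e : M ≃ₗ[R] N) : cls M = cls N := by
  have : Subsingleton (FGModuleCat.of R PUnit.{v + 1}) := inferInstanceAs (Subsingleton PUnit)
  have h := cls_prod (M' := N) (M'' := FGModuleCat.of R PUnit.{v + 1})
    (e.trans (LinearEquiv.prodUnique (R := R) (M := N) (M₂ := PUnit.{v + 1})).symm)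
  rwa [cls_eq_zero_of_subsingleton (FGModuleCat.of R PUnit.{v + 1}), add_zero] at h

theorem cls_pi {d : ℕ} (M : Fin d → FGModuleCat.{v} R) :
    cls (FGModuleCat.of R (∀ s, M s)) = ∑ s, cls (M s) := by
  induction d with
  | zero =>
    rw [Finset.univ_eq_empty, Finset.sum_empty]
    have : Subsingleton (FGModuleCat.of R (∀ s, M s)) := inferInstanceAs (Subsingleton (∀ s, M s))
    exact cls_eq_zero_of_subsingleton _
  | succ d ih =>
    rw [Fin.sum_univ_succ, ← ih fun s => M s.succ]
    exact cls_prod (M := FGModuleCat.of R (∀ s, M s)) (M' := M 0)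
      (M'' := FGModuleCat.of R (∀ s : Fin d, M s.succ))
      (Fin.consLinearEquiv R fun s => M s).symm

end StableGroup

/-! ### Simple modules and the image of `Ω̄`. -/

section VertexSimple

variable {K : Type u} [Field K] {Q : Type v} [Quiver.{w} Q] [Fintype Q] [DecidableEq Q]

/-- The space underlying the simple module at the vertex `j`. -/
def VertexSimple (K : Type u) {Q : Type v} [Quiver.{w} Q] (_ : Q) : Type (max u v w) :=
  ULift.{max v w} K

instance (j : Q) : AddCommGroup (VertexSimple K j) := inferInstanceAs (AddCommGroup (ULift K))

instance (j : Q) : Module K (VertexSimple K j) := inferInstanceAs (Module K (ULift K))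

instance (j : Q) : Module.Finite K (VertexSimple K j) :=
  Module.Finite.equiv (ULift.moduleEquiv (R := K) (M := K)).symm

instance (j : Q) : Module (Alg K Q)ᵐᵒᵖ (VertexSimple K j) where
  smul r x := eps K j (unop r) • x
  one_smul x := by
    change eps K j 1 • x = x
    rw [map_one, one_smul]
  mul_smul r s x := by
    change eps K j (unop s * unop r) • x = eps K j (unop r) • eps K j (unop s) • x
    rw [map_mul, mul_comm, mul_smul]
  smul_zero r := smul_zero (eps K j (unop r))
  smul_add r x y := smul_add (eps K j (unop r)) x y
  add_smul r s x := by
    change eps K j (unop r + unop s) • x = eps K j (unop r) • x + eps K j (unop s) • x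
    rw [map_add, add_smul]
  zero_smul x := by
    change eps K j 0 • x = 0
    rw [map_zero, zero_smul]

theorem op_smul_vertexSimple {j : Q} (a : Alg K Q) (x : VertexSimple K j) :
    op a • x = eps K j a • x := rfl

instance (j : Q) : IsScalarTower K (Alg K Q)ᵐᵒᵖ (VertexSimple K j) where
  smul_assoc c r x := by
    change eps K j (c • unop r) • x = c • eps K j (unop r) • x
    rw [eps_smul, mul_smul]

instance (j : Q) : Module.Finite (Alg K Q)ᵐᵒᵖ (VertexSimple K j) :=
  Module.Finite.of_restrictScalars_finite K _ _

variable (K) in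
/-- The simple module at the vertex `j`. -/
def simpleAt (j : Q) : FGModuleCat.{max u v w} (Alg K Q)ᵐᵒᵖ := FGModuleCat.of _ (VertexSimple K j)

/-- A module with a basis of elements on which the algebra acts through vertices is a direct sum of
simple modules. -/
theorem cls_eq_sum_of_basis {N : Type (max u v w)} [AddCommGroup N] [Module (Alg K Q)ᵐᵒᵖ N]
    [Module.Finite (Alg K Q)ᵐᵒᵖ N] [Module K N] [IsScalarTower K (Alg K Q)ᵐᵒᵖ N] {ι : Type*}
    [Fintype ι] (b : Module.Basis ι K N) (t : ι → Q)
    (h : ∀ s (a : Alg K Q), op a • b s = eps K (t s) a • b s) :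
    cls (FGModuleCat.of (Alg K Q)ᵐᵒᵖ N) = ∑ s, cls (simpleAt K (t s)) := by
  let e := Fintype.equivFin ι
  let b' := b.reindex e
  let t' : Fin (Fintype.card ι) → Q := t ∘ e.symm
  have h' : ∀ s (a : Alg K Q), op a • b' s = eps K (t' s) a • b' s := fun s a => by
    simp only [b', Module.Basis.reindex_apply]
    exact h _ a
  have hsum : ∑ s, cls (simpleAt K (t s)) = ∑ s, cls (simpleAt K (t' s)) :=
    Fintype.sum_equiv e _ _ fun s => by simp [t']
  rw [hsum, ← cls_pi fun s => simpleAt K (t' s)]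
  have hsc : ∀ (r : (Alg K Q)ᵐᵒᵖ) (c : K) (x : N), r • c • x = c • r • x := fun r c x => by
    rw [← algebraMap_smul (Alg K Q)ᵐᵒᵖ c x, ← algebraMap_smul (Alg K Q)ᵐᵒᵖ c (r • x), smul_smul,
      smul_smul, Algebra.commutes]
  let E : (∀ s, VertexSimple K (t' s)) ≃ₗ[K] N :=
    (LinearEquiv.piCongrRight fun s =>
      (ULift.moduleEquiv : VertexSimple K (t' s) ≃ₗ[K] K)).trans b'.equivFun.symm
  have hE : ∀ y, E y = ∑ s, (ULift.down (y s) : K) • b' s := fun y => b'.equivFun_symm_apply _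
  refine (cls_congr (M := FGModuleCat.of (Alg K Q)ᵐᵒᵖ (∀ s, VertexSimple K (t' s)))
    (N := FGModuleCat.of (Alg K Q)ᵐᵒᵖ N)
    { E.toAddEquiv with
      map_smul' := fun r y => ?_ }).symm
  obtain ⟨r, rfl⟩ := op_surjective r
  change E (op r • y) = op r • E y
  rw [hE, hE, Finset.smul_sum]
  refine Finset.sum_congr rfl fun s _ => ?_
  rw [hsc, h', smul_smul, mul_comm]
  rfl

variable (K Q) in
/-- The integral combinations of the classes of the simple modules. -/
def simpleComb : (Q → ℤ) →+ K0 (Alg K Q)ᵐᵒᵖ where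
  toFun v := ∑ j, v j • cls (simpleAt K j)
  map_zero' := by simp
  map_add' v v' := by simp [add_smul, Finset.sum_add_distrib]

theorem simpleComb_apply (v : Q → ℤ) : simpleComb K Q v = ∑ j, v j • cls (simpleAt K j) := rfl

theorem simpleComb_single (j : Q) : simpleComb K Q (Pi.single j 1) = cls (simpleAt K j) := by
  rw [simpleComb_apply, Finset.sum_eq_single j]
  · simp
  · intro k _ hk
    simp [Pi.single_eq_of_ne hk]
  · simp

variable [∀ i j : Q, Finite (i ⟶ j)]

/-- A module killed by the arrows, and vanishing at the sources, is a combination of simple modules at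
vertices which are not sources. -/
theorem exists_cls_eq_simpleComb (N : FGModuleCat.{max u v w} (Alg K Q)ᵐᵒᵖ)
    (hN : KilledByArrows K Q N)
    (hsrc : ∀ j : Q, (∀ i : Q, IsEmpty (i ⟶ j)) → ∀ x : N, op (idem K Q j) • x = 0) :
    ∃ v : Q → ℤ, (∀ j, (∀ i : Q, IsEmpty (i ⟶ j)) → v j = 0) ∧ cls N = simpleComb K Q v := by
  let _ : Module K N := Module.compHom N (algebraMap K (Alg K Q)ᵐᵒᵖ)
  have hK : ∀ (c : K) (x : N), c • x = op (c • (1 : Alg K Q)) • x := by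
    intro c x
    change algebraMap K (Alg K Q)ᵐᵒᵖ c • x = _
    rw [Algebra.algebraMap_eq_smul_one]
    rfl
  have : IsScalarTower K (Alg K Q)ᵐᵒᵖ N := IsScalarTower.of_algebraMap_smul fun _ _ => rfl
  have : Module.Finite K N := Module.Finite.trans (Alg K Q)ᵐᵒᵖ N
  let S : Set N := {x | ∃ j, op (idem K Q j) • x = x}
  -- Choosing the basis among elements concentrated at one vertex makes each basis vector span a
  -- simple submodule.
  obtain ⟨B, hBS, hBspan, hBli⟩ := exists_linearIndependent K S
  have hS : Submodule.span K S = ⊤ := by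
    rw [eq_top_iff]
    intro x _
    have h1 : x = ∑ i, op (idem K Q i) • x := by
      simp_rw [← orbitMap_apply]
      rw [← map_sum, sum_idem, orbitMap_apply, op_one, one_smul]
    rw [h1]
    refine Submodule.sum_mem _ fun i _ => Submodule.subset_span ⟨i, ?_⟩
    rw [op_smul_op_smul, idem_mul_self]
  let b : Module.Basis B K N := Module.Basis.mk hBli (by
    rw [Subtype.range_coe, hBspan, hS])
  have hb : ∀ s : B, b s = s := fun s => by simp [b]
  have : Fintype B := FiniteDimensional.fintypeBasisIndex b
  choose t ht using fun s : B => hBS s.2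
  have hcls := cls_eq_sum_of_basis b t fun s a => by
    rw [hb, hK]
    exact op_smul_of_killed (fun k c => hN _ _ c _) (ht s) a
  refine ⟨∑ s, Pi.single (t s) 1, fun j hj => ?_, ?_⟩
  · rw [Finset.sum_apply]
    refine Finset.sum_eq_zero fun s _ => Pi.single_eq_of_ne (fun h => ?_) _
    have h1 := hsrc j hj s
    rw [h, ht] at h1
    exact hBli.ne_zero s h1
  · rw [map_sum]
    simp_rw [simpleComb_single]
    exact hcls

/-- The image of `Ω̄` consists of combinations of simple modules at vertices which are not sources. -/
theorem exists_omegaBar_eq_simpleComb (z : K0 (Alg K Q)ᵐᵒᵖ) :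
    ∃ v : Q → ℤ, (∀ j, (∀ i : Q, IsEmpty (i ⟶ j)) → v j = 0) ∧
      omegaBar (Alg K Q)ᵐᵒᵖ z = simpleComb K Q v := by
  obtain ⟨z, rfl⟩ := QuotientAddGroup.mk_surjective z
  have hof : ∀ M : FGModuleCat.{max u v w} (Alg K Q)ᵐᵒᵖ, ∃ v : Q → ℤ,
      (∀ j, (∀ i : Q, IsEmpty (i ⟶ j)) → v j = 0) ∧
      omegaBar (Alg K Q)ᵐᵒᵖ (QuotientAddGroup.mk (FreeAbelianGroup.of M)) = simpleComb K Q v := by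
    intro M
    have h := omegaBar_cls M
    obtain ⟨v, hv1, hv2⟩ := exists_cls_eq_simpleComb (syzygy M) (syzygy_killedByArrows M) (by
      rintro j hj ⟨x, hx⟩
      exact Subtype.ext (idem_smul_eq_zero_of_mem_arrowRad hj
        (mem_arrowRad_of_mem_ker (exists_projectiveCover M).choose_spec.choose_spec hx)))
    exact ⟨v, hv1, h.trans hv2⟩
  induction z using FreeAbelianGroup.induction_on with
  | zero => exact ⟨0, fun _ _ => rfl, by rw [QuotientAddGroup.mk_zero, map_zero, map_zero]⟩
  | of M => exact hof M
  | neg M _ =>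
    obtain ⟨v, h1, h2⟩ := hof M
    exact ⟨-v, fun j hj => by rw [Pi.neg_apply, h1 j hj, neg_zero],
      by rw [QuotientAddGroup.mk_neg, map_neg, map_neg, h2]⟩
  | add x y hx hy =>
    obtain ⟨v, h1, h2⟩ := hx
    obtain ⟨v', h1', h2'⟩ := hy
    exact ⟨v + v', fun j hj => by rw [Pi.add_apply, h1 j hj, h1' j hj, add_zero],
      by rw [QuotientAddGroup.mk_add, map_add, map_add, h2, h2']⟩

end VertexSimple

/-! ### Syzygies of simple modules and the adjacency matrix. -/

section ProjectiveAt

variable (K : Type u) [Field K] {Q : Type v} [Quiver.{w} Q] [Fintype Q] [DecidableEq Q]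

/-- The indecomposable projective module `e_i A`, as an ideal of the opposite algebra. -/
def projAt (i : Q) : Submodule (Alg K Q)ᵐᵒᵖ (Alg K Q)ᵐᵒᵖ :=
  LinearMap.range (LinearMap.toSpanSingleton (Alg K Q)ᵐᵒᵖ (Alg K Q)ᵐᵒᵖ (op (idem K Q i)))

variable {K}

theorem idem_mul_of_mem_projAt {i : Q} {x : (Alg K Q)ᵐᵒᵖ} (hx : x ∈ projAt K i) :
    idem K Q i * unop x = unop x := by
  obtain ⟨r, rfl⟩ := hx
  change idem K Q i * (idem K Q i * unop r) = idem K Q i * unop r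
  rw [← mul_assoc, idem_mul_self]

theorem mem_projAt {i : Q} {x : Alg K Q} (hx : idem K Q i * x = x) : op x ∈ projAt K i :=
  ⟨op x, by rw [LinearMap.toSpanSingleton_apply, smul_eq_mul, ← op_mul, hx]⟩

theorem projAt_projective (i : Q) : Module.Projective (Alg K Q)ᵐᵒᵖ (projAt K i) :=
  Module.Projective.of_split (projAt K i).subtype (LinearMap.rangeRestrict _) (by
    ext x
    change (x : (Alg K Q)ᵐᵒᵖ) * op (idem K Q i) = x
    exact unop_injective (idem_mul_of_mem_projAt x.2))

variable (K) in
/-- The projection of `e_i A` onto the simple module at `i`. -/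
def projAtToSimple (i : Q) : projAt K i →ₗ[(Alg K Q)ᵐᵒᵖ] VertexSimple K i where
  toFun x := ULift.up (eps K i (unop (x : (Alg K Q)ᵐᵒᵖ)))
  map_add' x y := congrArg ULift.up (map_add (eps K i) _ _)
  map_smul' r x := by
    change ULift.up (eps K i (unop (x : (Alg K Q)ᵐᵒᵖ) * unop r)) =
      ULift.up (eps K i (unop r) * eps K i (unop (x : (Alg K Q)ᵐᵒᵖ)))
    rw [map_mul, mul_comm]

theorem eps_eq_zero_of_projAtToSimple_eq_zero {i : Q} {x : projAt K i}
    (hx : projAtToSimple K i x = 0) : eps K i (unop (x : (Alg K Q)ᵐᵒᵖ)) = 0 :=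
  congrArg ULift.down hx

theorem projAtToSimple_surjective (i : Q) : Function.Surjective (projAtToSimple K i) := by
  rintro ⟨c⟩
  refine ⟨⟨op (c • idem K Q i), mem_projAt ?_⟩, ?_⟩
  · rw [mul_smul_comm, idem_mul_self]
  · change ULift.up (eps K i (c • idem K Q i)) = _
    rw [eps_smul, eps_idem_self, mul_one]

variable (K) in
/-- The arrows starting at `i`, as elements of the radical of `e_i A`. -/
def arrowFamily (i : Q) (a : Σ j : Q, (i ⟶ j)) : LinearMap.ker (projAtToSimple K i) :=
  ⟨⟨op (arr K a.2), mem_projAt (idem_mul_arr K a.2)⟩, congrArg ULift.up (eps_arr K i a.2)⟩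

variable (K) in
/-- The inclusion of the radical of `e_i A` in the opposite algebra. -/
def kerIncl (i : Q) : LinearMap.ker (projAtToSimple K i) →ₗ[K] (Alg K Q)ᵐᵒᵖ where
  toFun x := (x : projAt K i)
  map_add' _ _ := rfl
  map_smul' _ _ := rfl

theorem kerIncl_injective (i : Q) : Function.Injective (kerIncl K i) :=
  fun _ _ h => Subtype.ext (Subtype.ext h)

theorem kerIncl_arrowFamily (i : Q) (a : Σ j : Q, (i ⟶ j)) :
    kerIncl K i (arrowFamily K i a) = op (arr K a.2) := rfl

variable [∀ i j : Q, Finite (i ⟶ j)]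

/-- At a sink `e_i A` has no arrows, so the simple module is itself projective. -/
theorem cls_simpleAt_sink {i : Q} (hi : ∀ j : Q, IsEmpty (i ⟶ j)) : cls (simpleAt K i) = 0 := by
  apply cls_projective
  have := projAt_projective (K := K) i
  refine Module.Projective.of_equiv (LinearEquiv.ofBijective (projAtToSimple K i)
    ⟨?_, projAtToSimple_surjective i⟩)
  rw [← LinearMap.ker_eq_bot, eq_bot_iff]
  intro x hx
  have h1 := eps_eq_zero_of_projAtToSimple_eq_zero hx
  have h2 := idem_mul_of_mem_projAt x.2
  rw [idem_mul, h1, zero_smul, zero_add, Finset.sum_eq_zero] at h2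
  · exact Subtype.ext (unop_injective h2.symm)
  · rintro ⟨j, k, a⟩ _
    dsimp only
    split_ifs with h
    · subst h
      exact ((hi k).false a).elim
    · rfl

variable (Q) in
/-- The adjacency matrix of the quiver. -/
def arrowMatrix : Matrix Q Q ℤ := Matrix.of fun i j => (Nat.card (i ⟶ j) : ℤ)

theorem arrowFamily_linearIndependent (i : Q) : LinearIndependent K (arrowFamily K i) := by
  classical
  have : ∀ j, Fintype (i ⟶ j) := fun j => Fintype.ofFinite _
  let co : LinearMap.ker (projAtToSimple K i) →ₗ[K] ((Σ j : Q, (i ⟶ j)) → K) :=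
    LinearMap.pi fun a => arrCoeff K a.2 ∘ₗ (opLinearEquiv K).symm.toLinearMap ∘ₗ kerIncl K i
  have hco : ⇑co ∘ arrowFamily K i = Pi.basisFun K (Σ j : Q, (i ⟶ j)) := by
    funext a b
    rw [Pi.basisFun_apply]
    change arrCoeff K b.2 (arr K a.2) = _
    by_cases hab : b = a
    · subst hab
      rw [arrCoeff_arr_self, Pi.single_eq_same]
    · rw [Pi.single_eq_of_ne hab]
      refine arrCoeff_arr_of_ne K (a := ⟨i, b⟩) (b := ⟨i, a⟩) fun h => hab ?_
      exact eq_of_heq (Sigma.mk.inj h).2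
  apply LinearIndependent.of_comp co
  rw [hco]
  exact (Pi.basisFun K _).linearIndependent

theorem span_arrowFamily (i : Q) : ⊤ ≤ Submodule.span K (Set.range (arrowFamily K i)) := by
  intro x _
  have h1 := eps_eq_zero_of_projAtToSimple_eq_zero x.2
  have h2 := idem_mul_of_mem_projAt x.1.2
  rw [idem_mul, h1, zero_smul, zero_add] at h2
  have h3 : kerIncl K i x ∈ (Submodule.span K (Set.range (arrowFamily K i))).map (kerIncl K i) := by
    have h4 : kerIncl K i x = opLinearEquiv K (unop (x.1 : (Alg K Q)ᵐᵒᵖ)) := rfl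
    rw [h4, ← h2, map_sum]
    refine Submodule.sum_mem _ ?_
    rintro ⟨j, k, a⟩ _
    dsimp only
    split_ifs with h
    · subst h
      rw [map_smul]
      exact Submodule.smul_mem _ _ ⟨_, Submodule.subset_span ⟨⟨k, a⟩, rfl⟩, rfl⟩
    · rw [map_zero]
      exact Submodule.zero_mem _
  obtain ⟨y, hy, hyx⟩ := h3
  exact kerIncl_injective i hyx ▸ hy

variable (K) in
/-- The arrows starting at `i` form a basis of the radical of `e_i A`. -/
def arrowBasis (i : Q) :
    Module.Basis (Σ j : Q, (i ⟶ j)) K (LinearMap.ker (projAtToSimple K i)) :=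
  Module.Basis.mk (arrowFamily_linearIndependent i) (span_arrowFamily i)

theorem arrowBasis_apply (i : Q) (a : Σ j : Q, (i ⟶ j)) :
    arrowBasis K i a = arrowFamily K i a := Module.Basis.mk_apply ..

theorem op_smul_arrowFamily (i : Q) (a : Σ j : Q, (i ⟶ j)) (r : Alg K Q) :
    op r • arrowFamily K i a = eps K a.1 r • arrowFamily K i a := by
  apply kerIncl_injective
  change op (arr K a.2 * r) = _
  rw [arr_mul, map_smul, kerIncl_arrowFamily, op_smul]

/-- The radical of `e_i A` has the arrows starting at `i` as a basis, and an arrow `i ⟶ j` spans a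
copy of the simple module at `j`. -/
theorem cls_syzygy_simpleAt (i : Q) :
    cls (syzygy (simpleAt K i)) = simpleComb K Q (arrowMatrix Q i) := by
  have : ∀ j, Fintype (i ⟶ j) := fun j => Fintype.ofFinite _
  rw [cls_syzygy (M := simpleAt K i) (FGModuleCat.of (Alg K Q)ᵐᵒᵖ (projAt K i)) (projAt_projective i)
    (projAtToSimple K i) (projAtToSimple_surjective i)]
  have h := cls_eq_sum_of_basis (K := K) (Q := Q) (N := LinearMap.ker (projAtToSimple K i))
    (ι := Σ j : Q, (i ⟶ j)) (arrowBasis K i) (fun a => a.1) fun a r => by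
    rw [arrowBasis_apply]
    exact op_smul_arrowFamily i a r
  refine h.trans ?_
  rw [simpleComb_apply, Fintype.sum_sigma]
  refine Finset.sum_congr rfl fun j _ => ?_
  change ∑ _y : (i ⟶ j), cls (simpleAt K j) = (Nat.card (i ⟶ j) : ℤ) • cls (simpleAt K j)
  rw [Finset.sum_const, Nat.card_eq_fintype_card, Finset.card_univ, natCast_zsmul]

theorem omegaBar_simpleComb (v : Q → ℤ) :
    omegaBar (Alg K Q)ᵐᵒᵖ (simpleComb K Q v) = simpleComb K Q (v ᵥ* arrowMatrix Q) := by
  have h1 : v ᵥ* arrowMatrix Q = ∑ j, v j • arrowMatrix Q j := by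
    ext k
    simp [vecMul, dotProduct, Finset.sum_apply]
  rw [h1, map_sum, simpleComb_apply, map_sum]
  refine Finset.sum_congr rfl fun j _ => ?_
  rw [map_zsmul, map_zsmul, omegaBar_cls, cls_syzygy_simpleAt]

theorem omegaBar_iterate_simpleComb (v : Q → ℤ) (m : ℕ) :
    (omegaBar (Alg K Q)ᵐᵒᵖ)^[m] (simpleComb K Q v) =
      simpleComb K Q (v ᵥ* arrowMatrix Q ^ m) := by
  induction m with
  | zero => simp
  | succ m ih =>
    rw [Function.iterate_succ_apply', ih, omegaBar_simpleComb, vecMul_vecMul, pow_succ]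

end ProjectiveAt

end RadSq

noncomputable section

namespace RadSq

open MulOpposite Matrix

/-! ### Independence of the simple modules that are not projective. -/

section Multiplicity

variable {K : Type u} [Field K] {Q : Type v} [Quiver.{w} Q] [Fintype Q] [DecidableEq Q]

variable (K) in
/-- The part of the socle of a right module at the vertex `j`. -/
def socleAt (N : Type*) [AddCommGroup N] [Module (Alg K Q)ᵐᵒᵖ N] [Fintype (Arrow Q)] (j : Q) :
    Submodule (Alg K Q)ᵐᵒᵖ N where
  carrier := {x | op (idem K Q j) • x = x ∧ ∀ (k : Q) (a : j ⟶ k), op (arr K a) • x = 0}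
  add_mem' hx hy := ⟨by rw [smul_add, hx.1, hy.1],
    fun k a => by rw [smul_add, hx.2, hy.2, add_zero]⟩
  zero_mem' := ⟨smul_zero _, fun _ _ => smul_zero _⟩
  smul_mem' r x hx := by
    obtain ⟨r, rfl⟩ := op_surjective r
    rw [op_smul_of_killed hx.2 hx.1]
    refine ⟨?_, fun k a => ?_⟩
    · rw [op_smul_op_smul, smul_mul_assoc, one_mul, op_smul_smul, hx.1]
    · rw [op_smul_op_smul, smul_mul_assoc, one_mul, op_smul_smul, hx.2, smul_zero]

/-- The product of two submodules is their product as modules. -/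
def submoduleProdEquiv {R M M' : Type*} [Ring R] [AddCommGroup M] [Module R M] [AddCommGroup M']
    [Module R M'] (p : Submodule R M) (q : Submodule R M') : p.prod q ≃ₗ[R] p × q where
  toFun x := (⟨x.1.1, x.2.1⟩, ⟨x.1.2, x.2.2⟩)
  invFun x := ⟨(x.1, x.2), x.1.2, x.2.2⟩
  map_add' _ _ := rfl
  map_smul' _ _ := rfl
  left_inv _ := rfl
  right_inv _ := rfl

theorem arrowRadAt_map_le {M N : Type*} [AddCommGroup M] [Module (Alg K Q)ᵐᵒᵖ M] [AddCommGroup N]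
    [Module (Alg K Q)ᵐᵒᵖ N] (f : M →ₗ[(Alg K Q)ᵐᵒᵖ] N) (j : Q) :
    (arrowRadAt K M j).map f ≤ arrowRadAt K N j := by
  rw [arrowRadAt, Submodule.map_span_le]
  rintro _ ⟨i, a, x, rfl⟩
  rw [map_smul]
  exact Submodule.subset_span ⟨i, a, f x, rfl⟩

theorem arrowRadAt_map {M N : Type*} [AddCommGroup M] [Module (Alg K Q)ᵐᵒᵖ M] [AddCommGroup N]
    [Module (Alg K Q)ᵐᵒᵖ N] (e : M ≃ₗ[(Alg K Q)ᵐᵒᵖ] N) (j : Q) :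
    (arrowRadAt K M j).map e.toLinearMap = arrowRadAt K N j := by
  refine le_antisymm (arrowRadAt_map_le _ j) fun y hy => ?_
  exact ⟨e.symm y, arrowRadAt_map_le e.symm.toLinearMap j ⟨y, hy, rfl⟩, e.apply_symm_apply y⟩

theorem arrowRadAt_prod (M N : Type*) [AddCommGroup M] [Module (Alg K Q)ᵐᵒᵖ M] [AddCommGroup N]
    [Module (Alg K Q)ᵐᵒᵖ N] (j : Q) :
    arrowRadAt K (M × N) j = (arrowRadAt K M j).prod (arrowRadAt K N j) := by
  apply le_antisymm
  · rw [arrowRadAt, Submodule.span_le]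
    rintro _ ⟨i, a, x, rfl⟩
    exact ⟨Submodule.subset_span ⟨i, a, x.1, rfl⟩, Submodule.subset_span ⟨i, a, x.2, rfl⟩⟩
  · rintro ⟨x, y⟩ ⟨hx, hy⟩
    have h : ((x, y) : M × N) = LinearMap.inl (Alg K Q)ᵐᵒᵖ M N x + LinearMap.inr (Alg K Q)ᵐᵒᵖ M N y := by simp
    rw [h]
    exact Submodule.add_mem _ (arrowRadAt_map_le _ j ⟨x, hx, rfl⟩)
      (arrowRadAt_map_le _ j ⟨y, hy, rfl⟩)

theorem vertexSimple_killedByArrows (i : Q) : KilledByArrows K Q (VertexSimple K i) := by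
  intro k l a x
  rw [op_smul_vertexSimple, eps_arr, zero_smul]

theorem arrowRadAt_simpleAt (i j : Q) : arrowRadAt K (VertexSimple K i) j = ⊥ :=
  le_bot_iff.1 ((arrowRadAt_le j).trans (arrowRad_eq_bot (vertexSimple_killedByArrows i)).le)

variable [∀ i j : Q, Finite (i ⟶ j)]

theorem socleAt_map {M N : Type*} [AddCommGroup M] [Module (Alg K Q)ᵐᵒᵖ M] [AddCommGroup N]
    [Module (Alg K Q)ᵐᵒᵖ N] (e : M ≃ₗ[(Alg K Q)ᵐᵒᵖ] N) (j : Q) :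
    (socleAt K M j).map e.toLinearMap = socleAt K N j := by
  ext y
  constructor
  · rintro ⟨x, hx, rfl⟩
    refine ⟨?_, fun k a => ?_⟩
    · change op (idem K Q j) • e x = e x
      rw [← map_smul, hx.1]
    · change op (arr K a) • e x = 0
      rw [← map_smul, hx.2, map_zero]
  · rintro ⟨h1, h2⟩
    refine ⟨e.symm y, ⟨?_, fun k a => ?_⟩, e.apply_symm_apply y⟩
    · rw [← map_smul, h1]
    · rw [← map_smul, h2, map_zero]

theorem socleAt_prod (M N : Type*) [AddCommGroup M] [Module (Alg K Q)ᵐᵒᵖ M] [AddCommGroup N]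
    [Module (Alg K Q)ᵐᵒᵖ N] (j : Q) :
    socleAt K (M × N) j = (socleAt K M j).prod (socleAt K N j) := by
  ext ⟨x, y⟩
  constructor
  · rintro ⟨h1, h2⟩
    exact ⟨⟨congrArg Prod.fst h1, fun k a => congrArg Prod.fst (h2 k a)⟩,
      ⟨congrArg Prod.snd h1, fun k a => congrArg Prod.snd (h2 k a)⟩⟩
  · rintro ⟨⟨h1, h2⟩, ⟨h3, h4⟩⟩
    exact ⟨Prod.ext h1 h3, fun k a => Prod.ext (h2 k a) (h4 k a)⟩

variable (K) in
/-- The multiplicity of the simple module at `j` as a direct summand. -/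
def simpleMult (j : Q) (M : FGModuleCat.{max u v w} (Alg K Q)ᵐᵒᵖ) : ℤ :=
  ((Module.length (Alg K Q)ᵐᵒᵖ (socleAt K M j)).toNat : ℤ) -
    ((Module.length (Alg K Q)ᵐᵒᵖ (arrowRadAt K M j)).toNat : ℤ)

/-- All lengths are finite here, so `toNat` never takes its default value at `⊤` and additivity
survives. -/
theorem length_toNat_prod {M N : Type*} [AddCommGroup M] [Module (Alg K Q)ᵐᵒᵖ M] [AddCommGroup N]
    [Module (Alg K Q)ᵐᵒᵖ N] [Module.Finite (Alg K Q)ᵐᵒᵖ M] [Module.Finite (Alg K Q)ᵐᵒᵖ N]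
    (p : Submodule (Alg K Q)ᵐᵒᵖ M) (q : Submodule (Alg K Q)ᵐᵒᵖ N) :
    (Module.length (Alg K Q)ᵐᵒᵖ (p.prod q)).toNat =
      (Module.length (Alg K Q)ᵐᵒᵖ p).toNat + (Module.length (Alg K Q)ᵐᵒᵖ q).toNat := by
  rw [(submoduleProdEquiv p q).length_eq, Module.length_prod,
    ENat.toNat_add Module.length_ne_top Module.length_ne_top]

theorem simpleMult_prod (j : Q) {M M' M'' : FGModuleCat.{max u v w} (Alg K Q)ᵐᵒᵖ}
    (e : M ≃ₗ[(Alg K Q)ᵐᵒᵖ] M' × M'') :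
    simpleMult K j M = simpleMult K j M' + simpleMult K j M'' := by
  have h1 := (e.submoduleMap (socleAt K M j)).length_eq
  have h2 := (e.submoduleMap (arrowRadAt K M j)).length_eq
  rw [socleAt_map, socleAt_prod] at h1
  rw [arrowRadAt_map, arrowRadAt_prod] at h2
  rw [simpleMult, h1, h2, length_toNat_prod, length_toNat_prod, simpleMult, simpleMult]
  push_cast
  ring

/-- In a projective module the socle at `j` and the radical at `j` coincide. An arrow leaving `j` is
needed: at a sink the simple module is projective and has multiplicity one in itself. -/
theorem simpleMult_projective {j k : Q} (a : j ⟶ k) (P : FGModuleCat.{max u v w} (Alg K Q)ᵐᵒᵖ)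
    (hP : Module.Projective (Alg K Q)ᵐᵒᵖ P) : simpleMult K j P = 0 := by
  have h : socleAt K P j = arrowRadAt K P j := by
    apply le_antisymm
    · intro x hx
      rw [← hx.1]
      exact idem_smul_mem_arrowRadAt a (hx.2 k a)
    · rw [arrowRadAt, Submodule.span_le]
      rintro _ ⟨i, b, x, rfl⟩
      refine ⟨?_, fun l c => ?_⟩
      · rw [op_smul_op_smul, arr_mul_idem]
      · rw [op_smul_op_smul, arr_mul_arr, op_zero, zero_smul]
  rw [simpleMult, h, sub_self]

instance (j : Q) : IsSimpleModule (Alg K Q)ᵐᵒᵖ (VertexSimple K j) := by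
  have : Nontrivial (VertexSimple K j) := inferInstanceAs (Nontrivial (ULift K))
  rw [isSimpleModule_iff_toSpanSingleton_surjective]
  refine ⟨this, fun x hx y => ?_⟩
  have hx' : ULift.down x ≠ 0 := fun h => hx (ULift.ext _ _ h)
  refine ⟨op ((ULift.down y / ULift.down x) • (1 : Alg K Q)), ?_⟩
  refine ULift.ext _ _ ?_
  change eps K j ((ULift.down y / ULift.down x) • (1 : Alg K Q)) * ULift.down x = ULift.down y
  rw [eps_smul, map_one, mul_one, div_mul_cancel₀ _ hx']

theorem socleAt_vertexSimple_self (i : Q) : socleAt K (VertexSimple K i) i = ⊤ := by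
  rw [eq_top_iff]
  intro x _
  refine ⟨?_, fun k a => vertexSimple_killedByArrows i _ _ a x⟩
  rw [op_smul_vertexSimple, eps_idem_self, one_smul]

theorem socleAt_vertexSimple_of_ne {i j : Q} (hij : i ≠ j) :
    socleAt K (VertexSimple K i) j = ⊥ := by
  rw [eq_bot_iff]
  intro x hx
  have h := hx.1
  rw [op_smul_vertexSimple, eps_idem_of_ne K hij, zero_smul] at h
  exact h.symm

theorem simpleMult_simpleAt (i j : Q) :
    simpleMult K j (simpleAt K i) = if i = j then 1 else 0 := by
  have h1 : (Module.length (Alg K Q)ᵐᵒᵖ (arrowRadAt K (simpleAt K i) j)).toNat = 0 := by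
    have h : arrowRadAt K (simpleAt K i) j = ⊥ := arrowRadAt_simpleAt i j
    rw [h, Module.length_bot, ENat.toNat_zero]
  rw [simpleMult, h1, Nat.cast_zero, sub_zero]
  split_ifs with hij
  · subst hij
    have h : socleAt K (simpleAt K i) i = ⊤ := socleAt_vertexSimple_self i
    have h2 : Module.length (Alg K Q)ᵐᵒᵖ (simpleAt K i) = 1 :=
      Module.length_eq_one (Alg K Q)ᵐᵒᵖ (VertexSimple K i)
    rw [h, Module.length_top, h2, ENat.toNat_one, Nat.cast_one]
  · have h : socleAt K (simpleAt K i) j = ⊥ := socleAt_vertexSimple_of_ne hij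
    rw [h, Module.length_bot, ENat.toNat_zero, Nat.cast_zero]

/-- The multiplicity of the simple module at a vertex `j` that is not a sink is defined on `K₀`. -/
theorem exists_multHom {j k : Q} (a : j ⟶ k) :
    ∃ m : K0 (Alg K Q)ᵐᵒᵖ →+ ℤ, ∀ v : Q → ℤ, m (simpleComb K Q v) = v j := by
  let m : K0 (Alg K Q)ᵐᵒᵖ →+ ℤ := QuotientAddGroup.lift (K0Relations (Alg K Q)ᵐᵒᵖ)
    (FreeAbelianGroup.lift (simpleMult K j)) (by
      refine (AddSubgroup.closure_le _).2 ?_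
      rintro _ (⟨M, M', M'', ⟨e⟩, rfl⟩ | ⟨P, hP, rfl⟩)
      · rw [SetLike.mem_coe, AddMonoidHom.mem_ker, map_sub, map_sub, FreeAbelianGroup.lift_apply_of,
          FreeAbelianGroup.lift_apply_of, FreeAbelianGroup.lift_apply_of, simpleMult_prod j e]
        ring
      · rw [SetLike.mem_coe, AddMonoidHom.mem_ker, FreeAbelianGroup.lift_apply_of,
          simpleMult_projective a P hP])
  have hm : ∀ M, m (cls M) = simpleMult K j M := fun M => by
    change FreeAbelianGroup.lift _ (FreeAbelianGroup.of M) = _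
    rw [FreeAbelianGroup.lift_apply_of]
  refine ⟨m, fun v => ?_⟩
  rw [simpleComb_apply, map_sum, Finset.sum_eq_single j]
  · rw [map_zsmul, hm, simpleMult_simpleAt, if_pos rfl, smul_eq_mul, mul_one]
  · intro i _ hi
    rw [map_zsmul, hm, simpleMult_simpleAt, if_neg hi, smul_zero]
  · simp

/-- The coefficients of `v` at vertices that are not sinks vanish by independence, and the rows of
the matrix at sinks are zero. -/
theorem vecMul_eq_zero_of_simpleComb_eq_zero {v : Q → ℤ} (hv : simpleComb K Q v = 0) :
    v ᵥ* arrowMatrix Q = 0 := by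
  ext k
  refine Finset.sum_eq_zero fun j _ => ?_
  rcases isEmpty_or_nonempty (j ⟶ k) with h | ⟨⟨a⟩⟩
  · simp [arrowMatrix]
  · obtain ⟨m, hm⟩ := exists_multHom (K := K) a
    have h := hm v
    rw [hv, map_zero] at h
    rw [← h, zero_mul]

end Multiplicity

/-! ### Paths, arrows and connectedness. -/

section Quivers

variable {Q : Type v} [Quiver.{w} Q]

theorem pathLE_iff_reflTransGen (x y : Q) : PathLE x y ↔ Relation.ReflTransGen (ArrowRel Q) x y := by
  constructor
  · rintro ⟨p⟩
    induction p with
    | nil => exact .refl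
    | cons _ a ih => exact ih.tail ⟨a⟩
  · intro h
    induction h with
    | refl => exact ⟨.nil⟩
    | tail _ h ih =>
      obtain ⟨p⟩ := ih
      obtain ⟨a⟩ := h
      exact ⟨p.cons a⟩

theorem entryRel_arrowMatrix [∀ i j : Q, Finite (i ⟶ j)] (i j : Q) : EntryRel (arrowMatrix Q) i j ↔ ArrowRel Q i j := by
  rw [EntryRel, ArrowRel, arrowMatrix, Matrix.of_apply, Ne, Nat.cast_eq_zero, Nat.card_eq_zero,
    not_or, not_isEmpty_iff]
  exact and_iff_left (not_infinite_iff_finite.2 inferInstance)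

theorem entryRel_arrowMatrix_eq [∀ i j : Q, Finite (i ⟶ j)] : EntryRel (arrowMatrix Q) = ArrowRel Q := by
  ext i j
  exact entryRel_arrowMatrix i j

/-- A connected quiver with two incomparable vertices has a third vertex. -/
theorem three_le_card_of_incomparable [Fintype Q] (hconn : Subsingleton (Quiver.WeaklyConnectedComponent Q))
    {x y : Q} (hxy : ¬ PathLE x y) (hyx : ¬ PathLE y x) : 3 ≤ Fintype.card Q := by
  classical
  by_contra! hcard
  have hne : x ≠ y := fun h => hxy (h ▸ ⟨.nil⟩)
  have hall : ∀ z, z = x ∨ z = y := by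
    intro z
    by_contra! h
    have h1 := Finset.card_le_univ ({z, x, y} : Finset Q)
    rw [Finset.card_eq_three.2 ⟨z, x, y, h.1, h.2, hne, rfl⟩] at h1
    lia
  -- If `x` and `y` were the only vertices, every arrow would be a loop, and no unoriented path
  -- could join them.
  have hloop : ∀ (a b : Q), (a ⟶ b) → a = b := by
    intro a b c
    rcases hall a with rfl | rfl <;> rcases hall b with rfl | rfl
    exacts [rfl, (hxy ⟨c.toPath⟩).elim, (hyx ⟨c.toPath⟩).elim, rfl]
  have hpath : ∀ {a b : Quiver.Symmetrify Q}, Quiver.Path a b → a = b := by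
    intro a b p
    induction p with
    | nil => rfl
    | cons _ c ih =>
      rcases c with c | c
      exacts [ih.trans (hloop _ _ c), ih.trans (hloop _ _ c).symm]
  obtain ⟨p⟩ := Quotient.exact (hconn.elim (Quiver.WeaklyConnectedComponent.mk x)
    (Quiver.WeaklyConnectedComponent.mk y))
  exact hne (hpath p)

end Quivers

/-! ### The bound for the `φ`-dimension. -/

section PhiDimension

variable {K : Type u} [Field K] {Q : Type v} [Quiver.{w} Q] [Fintype Q] [DecidableEq Q]
  [∀ i j : Q, Finite (i ⟶ j)]

/-- If `N` steps suffice for the adjacency matrix to annihilate, up to sinks, the vectors supported off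
the sources that it annihilates eventually, then `φ` is bounded by `N + 1`. -/
theorem phiDim_le {N : ℕ} (hN : ∀ (v : Q → ℤ) (t : ℕ), (∀ i, v i ≠ 0 → i ∈ level (ArrowRel Q) 1) →
      v ᵥ* arrowMatrix Q ^ t = 0 →
      ∀ i ∈ level (Function.swap (ArrowRel Q)) 1, (v ᵥ* arrowMatrix Q ^ N) i = 0) :
    phiDim (Alg K Q)ᵐᵒᵖ ≤ (N + 1 : ℕ) := by
  refine iSup_le fun M => sInf_le ⟨N + 1, fun s => ?_, rfl⟩
  rintro _ ⟨x, hx, rfl⟩ _ ⟨y, hy, rfl⟩ hxy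
  have hiter : ∀ (m : ℕ) (z : K0 (Alg K Q)ᵐᵒᵖ), (omegaBar (Alg K Q)ᵐᵒᵖ)^[m + 1] z =
      (omegaBar (Alg K Q)ᵐᵒᵖ)^[m] (omegaBar (Alg K Q)ᵐᵒᵖ z) := fun m z => rfl
  rw [← sub_eq_zero, ← iterate_map_sub]
  rw [← sub_eq_zero, ← map_sub, ← iterate_map_sub,
    ← Function.iterate_succ_apply' (omegaBar (Alg K Q)ᵐᵒᵖ)] at hxy
  -- One application of `Ω̄` is spent on reaching the span of the simples; this is the `+ 1` in the
  -- bound. The remaining iterates are powers of the matrix applied to `v`.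
  obtain ⟨v, hv1, hv2⟩ := exists_omegaBar_eq_simpleComb (x - y)
  rw [show (N + 1 + s).succ = (N + s + 1) + 1 by lia, hiter, hv2, omegaBar_iterate_simpleComb] at hxy
  have h1 := vecMul_eq_zero_of_simpleComb_eq_zero hxy
  rw [vecMul_vecMul, ← pow_succ] at h1
  have h2 := hN v _ (fun i hi => by
    by_contra h
    exact hi (hv1 i fun k => ⟨fun a => h ⟨k, trivial, ⟨a⟩⟩⟩)) h1
  have h3 : simpleComb K Q (v ᵥ* arrowMatrix Q ^ N) = 0 := by
    rw [simpleComb_apply]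
    refine Finset.sum_eq_zero fun j _ => ?_
    by_cases hj : j ∈ level (Function.swap (ArrowRel Q)) 1
    · rw [h2 j hj, zero_smul]
    · rw [cls_simpleAt_sink fun k => ⟨fun a => hj ⟨k, trivial, ⟨a⟩⟩⟩, smul_zero]
  rw [show N + 1 + s = (s + N) + 1 by lia, hiter, hv2, Function.iterate_add_apply,
    omegaBar_iterate_simpleComb, h3, iterate_map_zero]

end PhiDimension

end RadSq

end

theorem proposition4p28 (K : Type u) [Field K] (Q : Type v) [Quiver.{w} Q] [Fintype Q]
    [DecidableEq Q] [∀ i j : Q, Finite (i ⟶ j)]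
    (hconn : Subsingleton (Quiver.WeaklyConnectedComponent Q))
    (hM : (RadSq.member K Q).Nonempty)
    (hphi : RadSq.phiDim (RadSq.Alg K Q)ᵐᵒᵖ = ((Fintype.card Q - 1 : ℕ) : ℕ∞)) :
    IsLinearOrder (RadSq.member K Q)
      (fun x y : RadSq.member K Q => RadSq.PathLE (x : Q) (y : Q)) := by
  have hcore : RadSq.core (RadSq.arrowMatrix Q) ⊆ RadSq.heart K Q := by
    rw [RadSq.core, RadSq.entryRel_arrowMatrix_eq]
    exact RadSq.level_inter_subset_heart K Q
  refine { refl := fun x => ⟨.nil⟩, trans := fun x y z => ?_, antisymm := ?_, total := ?_ }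
  · rintro ⟨p⟩ ⟨q⟩
    exact ⟨p.comp q⟩
  · rintro ⟨x, hx⟩ ⟨y, hy⟩ hxy hyx
    rw [RadSq.pathLE_iff_reflTransGen] at hxy hyx
    by_contra hne
    have hne' : x ≠ y := fun h => hne (Subtype.ext h)
    have h1 : Relation.TransGen (RadSq.ArrowRel Q) x x :=
      ((Relation.reflTransGen_iff_eq_or_transGen.1 hxy).resolve_left hne'.symm).trans_left hyx
    have h2 : Relation.TransGen (Function.swap (RadSq.ArrowRel Q)) x x :=
      Relation.transGen_swap.2 h1
    exact hx (RadSq.level_inter_subset_heart K Q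
      ⟨RadSq.mem_level_of_transGen_self _ _ h1, RadSq.mem_level_of_transGen_self _ _ h2⟩)
  · rintro ⟨x, hx⟩ ⟨y, hy⟩
    by_contra! hcon
    obtain ⟨hxy, hyx⟩ := hcon
    -- The truncated `n - 3` must be genuine: for `n = 2` the bound `n - 3 + 1` would equal `n - 1`
    -- and give no contradiction.
    have hcard := RadSq.three_le_card_of_incomparable hconn hxy hyx
    rw [RadSq.pathLE_iff_reflTransGen, ← RadSq.entryRel_arrowMatrix_eq] at hxy hyx
    have h := RadSq.phiDim_le (K := K) (Q := Q) (N := Fintype.card Q - 3) fun v t hv ht => by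
      rw [← RadSq.entryRel_arrowMatrix_eq] at hv ⊢
      exact RadSq.vecMul_pow_card_sub_three (fun i j => Int.natCast_nonneg _)
        (fun h => hx (hcore h)) (fun h => hy (hcore h)) hxy hyx hv ht
    rw [hphi, Nat.cast_le] at h
    lia
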